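/- Let $k$ be a field. For $n\ge 2$ let $Q_n$ be the quiver $1\to 2\to\cdots\to n$, and let $kQ_n$ be its path algebra, with arrows composed from left to right. For a finite-dimensional $k$-algebra $A$ let $DA=\operatorname{Hom}_k(A,k)$ and let $T(A)=A\oplus DA$ be the trivial extension, with multiplication $(a,f)(b,g)=(ab,ag+fb)$. Modules are finite-dimensional right modules, and $\operatorname{mod}A$ is the category of these. Let $S_i$ be the simple $kQ_n$-module supported at the vertex $i$ and $P_i=e_ikQ_n$ its projective cover over $kQ_n$; both are regarded as $T(kQ_n)$-modules through the projection $T(kQ_n)\to kQ_n$. For an integer $d\ge 2$, a module $M$ over a finite-dimensional $k$-algebra $B$ is called $d$-cluster-tilting if $\mathcal U=\operatorname{add}M$ (the direct summands of finite direct sums of copies of $M$) is functorially finite in $\operatorname{mod}B$ and $$\mathcal U=\{X\in\operatorname{mod}B\mid \operatorname{Ext}^i_B(X,U)=0\ \ \forall\,U\in\mathcal U,\ 1\le i\le d-1\}=\{X\in\operatorname{mod}B\mid \operatorname{Ext}^i_B(U,X)=0\ \ \forall\,U\in\mathcal U,\ 1\le i\le d-1\}.$$ Then the following hold. 1. For every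 $n\ge 2$, the module $P_n\oplus T(kQ_n)$ is a $(2n-1)$-cluster-tilting module of $T(kQ_n)$. 2. The module $P_1\oplus P_2\oplus S_2\oplus T(kQ_3)$ is a $2$-cluster-tilting module of $T(kQ_3)$. 3. The module $T(kQ_6)\oplus\bigoplus_{i=0}^{3}\Omega^{3i}_{T(kQ_6)}(P_5\oplus P_6)$ is a $2$-cluster-tilting module of $T(kQ_6)$. Here $\Omega^{j}$ is the $j$-th syzygy, that is, the result of taking $j$ times the kernel of an epimorphism from a finitely generated projective module; the claim holds for every choice of these epimorphisms (in particular for projective covers). -/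

import Mathlib

open CategoryTheory CategoryTheory.Limits CategoryTheory.Abelian MulOpposite

universe w v u

attribute [local instance] Abelian.hasFiniteBiproducts

/-! ### Cluster-tilting subcategories of an abelian category -/

section ClusterTilting

variable {C : Type u} [Category.{v} C]

/-- `f : U ⟶ X` is a right `𝒰`-approximation of `X`: `U` lies in `𝒰`, and every morphism from an
object of `𝒰` to `X` factors through `f`. -/
def IsRightApproximation (𝒰 : ObjectProperty C) {U X : C} (f : U ⟶ X) : Prop :=
  𝒰 U ∧ ∀ ⦃V : C⦄, 𝒰 V → ∀ g : V ⟶ X, ∃ h : V ⟶ U, h ≫ f = g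

/-- `f : X ⟶ U` is a left `𝒰`-approximation of `X`: `U` lies in `𝒰`, and every morphism from `X`
to an object of `𝒰` factors through `f`. -/
def IsLeftApproximation (𝒰 : ObjectProperty C) {X U : C} (f : X ⟶ U) : Prop :=
  𝒰 U ∧ ∀ ⦃V : C⦄, 𝒰 V → ∀ g : X ⟶ V, ∃ h : U ⟶ V, f ≫ h = g

/-- A full subcategory is functorially finite if every object of the ambient category has both a
right and a left approximation by it. -/
def IsFunctoriallyFinite (𝒰 : ObjectProperty C) : Prop :=
  (∀ X : C, ∃ (U : C) (f : U ⟶ X), IsRightApproximation 𝒰 f) ∧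
    (∀ X : C, ∃ (U : C) (f : X ⟶ U), IsLeftApproximation 𝒰 f)

variable [Abelian C]

/-- `𝒰` is a `d`-cluster-tilting subcategory of the abelian category `C`: it is functorially
finite, and it consists exactly of the objects `X` with `Ext^i(X, U) = 0` for all `U` in `𝒰` and
`1 ≤ i ≤ d - 1`, and also exactly of the objects `X` with `Ext^i(U, X) = 0` for these `U`, `i`. -/
def IsClusterTilting [HasExt.{w} C] (d : ℕ) (𝒰 : ObjectProperty C) : Prop :=
  IsFunctoriallyFinite 𝒰 ∧
    (∀ X : C, 𝒰 X ↔ ∀ U : C, 𝒰 U → ∀ i : ℕ, 1 ≤ i → i + 1 ≤ d → Subsingleton (Ext.{w} X U i)) ∧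
    (∀ X : C, 𝒰 X ↔ ∀ U : C, 𝒰 U → ∀ i : ℕ, 1 ≤ i → i + 1 ≤ d → Subsingleton (Ext.{w} U X i))

/-- The additive closure of `M`: the direct summands of the finite direct sums of copies of `M`. -/
def additiveClosure (M : C) : ObjectProperty C := fun X =>
  ∃ m : ℕ, Nonempty (Retract X (⨁ fun _ : Fin m => M))

/-- `N` is a `j`-th syzygy of `M`: up to isomorphism, it is obtained from `M` by taking `j` times
the kernel of an epimorphism from a projective object. Projective covers are a special case; any
other choice changes `N` by projective direct summands only. -/
def IsSyzygy (M : C) : ℕ → C → Prop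
  | 0, N => Nonempty (N ≅ M)
  | j + 1, N => ∃ (L Q : C) (i : N ⟶ Q) (p : Q ⟶ L) (w : i ≫ p = 0),
      IsSyzygy M j L ∧ Projective Q ∧ (ShortComplex.mk i p w).ShortExact

theorem exists_isSyzygy [EnoughProjectives C] (M : C) (j : ℕ) : ∃ N : C, IsSyzygy M j N := by
  induction j with
  | zero => exact ⟨M, ⟨Iso.refl M⟩⟩
  | succ j ih =>
    obtain ⟨L, hL⟩ := ih
    refine ⟨kernel (Projective.π L), L, Projective.over L, kernel.ι _, Projective.π L,
      kernel.condition _, hL, inferInstance, ?_⟩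
    exact { exact := ShortComplex.exact_kernel _ }

end ClusterTilting

/-! ### Finitely generated modules -/

section Modules

instance FGModuleCat.enoughProjectives_of_noetherian (R : Type u) [Ring R] [IsNoetherianRing R] :
    EnoughProjectives (FGModuleCat.{u} R) where
  presentation X := by
    obtain ⟨n, f, hf⟩ := Module.Finite.exists_fin' R X
    refine ⟨{ p := FGModuleCat.of R (Fin n → R), projective := ?_, f := FGModuleCat.ofHom f,
              epi := ?_ }⟩
    · constructor
      intro E Y g e he
      have he' : Function.Surjective e.hom.hom := by
        have : Epi ((forget₂ (FGModuleCat.{u} R) (ModuleCat.{u} R)).map e) := inferInstance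
        exact (ModuleCat.epi_iff_surjective _).1 this
      obtain ⟨h, hh⟩ := Module.projective_lifting_property e.hom.hom g.hom.hom he'
      exact ⟨FGModuleCat.ofHom h, FGModuleCat.hom_ext hh⟩
    · have : Epi ((forget₂ (FGModuleCat.{u} R) (ModuleCat.{u} R)).map (FGModuleCat.ofHom f)) :=
        (ModuleCat.epi_iff_surjective _).2 hf
      exact (forget₂ (FGModuleCat.{u} R) (ModuleCat.{u} R)).epi_of_epi_map this

instance FGModuleCat.hasExt_of_noetherian (R : Type u) [Ring R] [IsNoetherianRing R] :
    HasExt.{u} (FGModuleCat.{u} R) :=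
  hasExt_of_enoughProjectives.{u} _

theorem finite_restrictScalars_of_surjective {R S : Type u} [Ring R] [Ring S] (f : R →+* S)
    (hf : Function.Surjective f) (M : ModuleCat.{u} S) [Module.Finite S M] :
    Module.Finite R ((ModuleCat.restrictScalars f).obj M) := by
  let _ : Module R M := Module.compHom M f
  obtain ⟨s, hs⟩ := (inferInstance : Module.Finite S M).fg_top
  have key : (Submodule.span R (s : Set M)) = ⊤ := by
    rw [eq_top_iff]
    intro x _
    have hx : x ∈ Submodule.span S (s : Set M) := by rw [hs]; trivial
    induction hx using Submodule.span_induction with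
    | mem x h => exact Submodule.subset_span h
    | zero => exact Submodule.zero_mem _
    | add x y _ _ hx hy => exact Submodule.add_mem _ (hx trivial) (hy trivial)
    | smul a x _ hx =>
      obtain ⟨r, rfl⟩ := hf a
      exact Submodule.smul_mem _ r (hx trivial)
  exact ⟨⟨s, key⟩⟩

/-- Restriction of scalars of finitely generated modules along a surjective ring homomorphism. -/
noncomputable def FGModuleCat.inflate {R S : Type u} [Ring R] [Ring S] (f : R →+* S)
    (hf : Function.Surjective f) (M : FGModuleCat.{u} S) : FGModuleCat.{u} R :=
  ⟨(ModuleCat.restrictScalars f).obj M.obj,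
    haveI : Module.Finite S M.obj := M.property
    finite_restrictScalars_of_surjective f hf M.obj⟩

/-- The category `mod A` of right `A`-modules (that is, modules over the opposite ring) that are
finitely generated. When `A` is a finite-dimensional algebra over a field, these are exactly the
finite-dimensional right `A`-modules. -/
abbrev RightMod (A : Type u) [Ring A] : Type (u + 1) := FGModuleCat.{u} Aᵐᵒᵖ

instance finite_op_self (A : Type u) [Ring A] : Module.Finite Aᵐᵒᵖ A :=
  ⟨⟨{1}, by
    rw [eq_top_iff]
    intro x _
    rw [Finset.coe_singleton, Submodule.mem_span_singleton]
    exact ⟨op x, by simp⟩⟩⟩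

/-- `A` as a right module over itself. -/
noncomputable abbrev regularModule (A : Type u) [Ring A] : RightMod A := FGModuleCat.of Aᵐᵒᵖ A

/-- `M` is a `d`-cluster-tilting `A`-module: `add M` is `d`-cluster-tilting in `mod A`. -/
def IsClusterTiltingModule (A : Type u) [Ring A] [IsNoetherianRing Aᵐᵒᵖ] (d : ℕ)
    (M : RightMod A) : Prop :=
  IsClusterTilting.{u} d (additiveClosure M)

end Modules

/-! ### Trivial extension algebras -/

section TrivialExtension

variable (k : Type u) (A : Type u) [Field k] [Ring A] [Algebra k A]

/-- The `A`-bimodule `DA = Hom_k(A, k)`, with `(a f)(x) = f (x a)` and `(f a)(x) = f (a x)`. -/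
def DualBimodule : Type u := A →ₗ[k] k

namespace DualBimodule

instance : AddCommGroup (DualBimodule k A) := inferInstanceAs (AddCommGroup (A →ₗ[k] k))

instance : Module k (DualBimodule k A) := inferInstanceAs (Module k (A →ₗ[k] k))

instance : FunLike (DualBimodule k A) A k := inferInstanceAs (FunLike (A →ₗ[k] k) A k)

variable {k A}

@[ext] theorem ext {f g : DualBimodule k A} (h : ∀ x, f x = g x) : f = g := LinearMap.ext h

instance : Module A (DualBimodule k A) where
  smul a f := LinearMap.comp (show A →ₗ[k] k from f) (LinearMap.mulRight k a)
  one_smul f := ext fun x => congrArg f (mul_one x)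
  mul_smul a b f := ext fun x => congrArg f (mul_assoc x a b).symm
  smul_zero _ := rfl
  smul_add _ _ _ := rfl
  add_smul a b f := ext fun x => (congrArg f (mul_add x a b)).trans
    (map_add (show A →ₗ[k] k from f) _ _)
  zero_smul f := ext fun x => (congrArg f (mul_zero x)).trans (map_zero (show A →ₗ[k] k from f))

instance : Module Aᵐᵒᵖ (DualBimodule k A) where
  smul a f := LinearMap.comp (show A →ₗ[k] k from f) (LinearMap.mulLeft k a.unop)
  one_smul f := ext fun x => congrArg f (one_mul x)
  mul_smul a b f := ext fun x => congrArg f (mul_assoc b.unop a.unop x)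
  smul_zero _ := rfl
  smul_add _ _ _ := rfl
  add_smul a b f := ext fun x => (congrArg f (add_mul a.unop b.unop x)).trans
    (map_add (show A →ₗ[k] k from f) _ _)
  zero_smul f := ext fun x => (congrArg f (zero_mul x)).trans (map_zero (show A →ₗ[k] k from f))

theorem smul_apply (a : A) (f : DualBimodule k A) (x : A) : (a • f) x = f (x * a) := rfl

theorem op_smul_apply (a : A) (f : DualBimodule k A) (x : A) : (op a • f) x = f (a * x) := rfl

instance : SMulCommClass A Aᵐᵒᵖ (DualBimodule k A) where
  smul_comm a b f := ext fun x => congrArg f (mul_assoc b.unop x a).symm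

instance : IsScalarTower k A (DualBimodule k A) where
  smul_assoc c a f := ext fun x =>
    (congrArg f (mul_smul_comm c x a)).trans (map_smul (show A →ₗ[k] k from f) c (x * a))

instance : IsScalarTower k Aᵐᵒᵖ (DualBimodule k A) where
  smul_assoc c a f := ext fun x =>
    (congrArg f (smul_mul_assoc c a.unop x)).trans
      (map_smul (show A →ₗ[k] k from f) c (a.unop * x))

instance [Module.Finite k A] : Module.Finite k (DualBimodule k A) :=
  inferInstanceAs (Module.Finite k (A →ₗ[k] k))

end DualBimodule

/-- The trivial extension `T(A) = A ⊕ DA`, with `(a, f) (b, g) = (a b, a g + f b)`. -/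
abbrev TrivialExtension : Type u := TrivSqZeroExt A (DualBimodule k A)

instance TrivialExtension.module_finite [Module.Finite k A] :
    Module.Finite k (TrivialExtension k A) :=
  inferInstanceAs (Module.Finite k (A × DualBimodule k A))

instance TrivialExtension.isNoetherianRing_op [Module.Finite k A] :
    IsNoetherianRing (TrivialExtension k A)ᵐᵒᵖ :=
  have : Module.Finite k (TrivialExtension k A)ᵐᵒᵖ :=
    Module.Finite.equiv (MulOpposite.opLinearEquiv k (M := TrivialExtension k A))
  IsNoetherianRing.of_finite k _

/-- An `A`-module, regarded as a `T(A)`-module through the projection `T(A) → A`. -/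
noncomputable def TrivialExtension.inflate (M : RightMod A) : RightMod (TrivialExtension k A) :=
  FGModuleCat.inflate
    (RingHom.op (TrivSqZeroExt.fstHom k A (DualBimodule k A)).toRingHom)
    (fun a => ⟨op (TrivSqZeroExt.inl a.unop), rfl⟩) M

end TrivialExtension

/-! ### Path algebras -/

section PathAlgebra

variable (k : Type u) [Field k] (Q : Type) [Quiver.{0} Q]

/-- The set of all paths of the quiver `Q`, including the trivial ones. -/
abbrev Quiver.AllPaths : Type := Σ a b : Q, Quiver.Path a b

/-- The underlying vector space of the path algebra: it has the set of paths as a basis. -/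
def PathAlgebra : Type u := Quiver.AllPaths Q →₀ k

namespace PathAlgebra

noncomputable instance : AddCommGroup (PathAlgebra k Q) :=
  inferInstanceAs (AddCommGroup (Quiver.AllPaths Q →₀ k))

noncomputable instance : Module k (PathAlgebra k Q) :=
  inferInstanceAs (Module k (Quiver.AllPaths Q →₀ k))

variable {Q}

/-- The basis element given by a path. -/
noncomputable def ofPath {a b : Q} (p : Quiver.Path a b) : PathAlgebra k Q :=
  Finsupp.single (⟨a, b, p⟩ : Quiver.AllPaths Q) (1 : k)

open Classical in
/-- The product of two paths in the path algebra, composed from left to right: `p q` is the path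
`p` followed by `q` if `q` starts where `p` ends, and zero otherwise. -/
noncomputable def mulPath (p q : Quiver.AllPaths Q) : PathAlgebra k Q :=
  if h : p.2.1 = q.1 then ofPath k (p.2.2.comp (q.2.2.cast h.symm rfl)) else 0

variable (Q) in
/-- Multiplication of the path algebra, as the bilinear extension of the product of paths. -/
noncomputable def mulₗ : PathAlgebra k Q →ₗ[k] PathAlgebra k Q →ₗ[k] PathAlgebra k Q :=
  Finsupp.lift (PathAlgebra k Q →ₗ[k] PathAlgebra k Q) k (Quiver.AllPaths Q) fun p =>
    Finsupp.lift (PathAlgebra k Q) k (Quiver.AllPaths Q) fun q => mulPath k p q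

noncomputable instance : Mul (PathAlgebra k Q) := ⟨fun x y => mulₗ k Q x y⟩

noncomputable instance [Fintype Q] : One (PathAlgebra k Q) :=
  ⟨∑ a : Q, ofPath k (Quiver.Path.nil : Quiver.Path a a)⟩

variable {k}

theorem mul_def (x y : PathAlgebra k Q) : x * y = mulₗ k Q x y := rfl

theorem lift_single_one {X M : Type*} [AddCommGroup M] [Module k M] (F : X → M) (x : X) :
    Finsupp.lift M k X F (Finsupp.single x 1) = F x := by
  simp

theorem mulₗ_ofPath {a b c d : Q} (p : Quiver.Path a b) (q : Quiver.Path c d) :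
    mulₗ k Q (ofPath k p) (ofPath k q) = mulPath k ⟨a, b, p⟩ ⟨c, d, q⟩ := by
  have h1 : mulₗ k Q (ofPath k p) = Finsupp.lift (PathAlgebra k Q) k (Quiver.AllPaths Q)
      fun q => mulPath k ⟨a, b, p⟩ q :=
    lift_single_one _ _
  rw [h1]
  exact lift_single_one _ _

theorem ofPath_mul_ofPath {a b c : Q} (p : Quiver.Path a b) (q : Quiver.Path b c) :
    ofPath k p * ofPath k q = ofPath k (p.comp q) := by
  rw [mul_def, mulₗ_ofPath]
  simp [mulPath]

theorem ofPath_mul_ofPath_of_ne {a b c d : Q} (p : Quiver.Path a b) (q : Quiver.Path c d)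
    (h : b ≠ c) : ofPath k p * ofPath k q = 0 := by
  rw [mul_def, mulₗ_ofPath]
  simp [mulPath, h]

/-- A linear map on the path algebra is determined by its values on the paths. -/
theorem hom_ext {M : Type*} [AddCommGroup M] [Module k M] {f g : PathAlgebra k Q →ₗ[k] M}
    (h : ∀ (a b : Q) (p : Quiver.Path a b), f (ofPath k p) = g (ofPath k p)) : f = g :=
  Finsupp.lhom_ext' fun p => LinearMap.ext_ring (h p.1 p.2.1 p.2.2)

theorem mul_assoc_aux (x y z : PathAlgebra k Q) : x * y * z = x * (y * z) := by
  have key : (mulₗ k Q).compr₂ (mulₗ k Q) =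
      LinearMap.lcomp k (PathAlgebra k Q →ₗ[k] PathAlgebra k Q) (mulₗ k Q) ∘ₗ
        LinearMap.llcomp k (PathAlgebra k Q) (PathAlgebra k Q) (PathAlgebra k Q) ∘ₗ mulₗ k Q := by
    refine hom_ext fun a b p => hom_ext fun c d q => hom_ext fun e f r => ?_
    change ofPath k p * ofPath k q * ofPath k r = ofPath k p * (ofPath k q * ofPath k r)
    by_cases h : b = c
    · subst h
      by_cases h' : d = e
      · subst h'
        simp only [ofPath_mul_ofPath, Quiver.Path.comp_assoc]
      · rw [ofPath_mul_ofPath, ofPath_mul_ofPath_of_ne _ _ h', ofPath_mul_ofPath_of_ne _ _ h',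
          mul_def, map_zero]
    · rw [ofPath_mul_ofPath_of_ne _ _ h]
      by_cases h' : d = e
      · subst h'
        rw [ofPath_mul_ofPath, ofPath_mul_ofPath_of_ne _ _ h, mul_def, map_zero,
          LinearMap.zero_apply]
      · rw [ofPath_mul_ofPath_of_ne _ _ h', mul_def, mul_def, map_zero, map_zero,
          LinearMap.zero_apply]
  exact LinearMap.congr_fun (LinearMap.congr_fun (LinearMap.congr_fun key x) y) z

theorem one_def [Fintype Q] :
    (1 : PathAlgebra k Q) = ∑ a : Q, ofPath k (Quiver.Path.nil : Quiver.Path a a) := rfl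

theorem one_mul_aux [Fintype Q] (x : PathAlgebra k Q) : 1 * x = x := by
  classical
  have key : mulₗ k Q 1 = LinearMap.id := by
    refine hom_ext fun a b p => ?_
    rw [one_def, map_sum, LinearMap.sum_apply, Finset.sum_eq_single a]
    · rw [← mul_def, ofPath_mul_ofPath, Quiver.Path.nil_comp]; rfl
    · intro c _ hc
      rw [← mul_def, ofPath_mul_ofPath_of_ne _ _ hc]
    · simp
  exact LinearMap.congr_fun key x

theorem mul_one_aux [Fintype Q] (x : PathAlgebra k Q) : x * 1 = x := by
  classical
  have key : (mulₗ k Q).flip 1 = LinearMap.id := by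
    refine hom_ext fun a b p => ?_
    rw [LinearMap.flip_apply, one_def, map_sum, Finset.sum_eq_single b]
    · rw [← mul_def, ofPath_mul_ofPath, Quiver.Path.comp_nil]; rfl
    · intro c _ hc
      rw [← mul_def, ofPath_mul_ofPath_of_ne _ _ hc.symm]
    · simp
  exact LinearMap.congr_fun key x

noncomputable instance [Fintype Q] : Ring (PathAlgebra k Q) where
  __ := (inferInstance : AddCommGroup (PathAlgebra k Q))
  mul_assoc := mul_assoc_aux
  one_mul := one_mul_aux
  mul_one := mul_one_aux
  left_distrib x y z := map_add (mulₗ k Q x) y z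
  right_distrib x y z := LinearMap.map_add₂ (mulₗ k Q) x y z
  zero_mul x := LinearMap.map_zero₂ (mulₗ k Q) x
  mul_zero x := map_zero (mulₗ k Q x)

/-- The path algebra `kQ` of a quiver with finitely many vertices, as a `k`-algebra. -/
noncomputable instance [Fintype Q] : Algebra k (PathAlgebra k Q) :=
  Algebra.ofModule (fun c x y => LinearMap.map_smul₂ (mulₗ k Q) c x y)
    (fun c x y => map_smul (mulₗ k Q x) c y)

instance [Fintype Q] [Finite (Quiver.AllPaths Q)] : Module.Finite k (PathAlgebra k Q) :=
  inferInstanceAs (Module.Finite k (Quiver.AllPaths Q →₀ k))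

variable [Fintype Q]

variable (k) in
/-- The trivial path at `i`, as an idempotent of the path algebra. -/
noncomputable def idem (i : Q) : PathAlgebra k Q := ofPath k (Quiver.Path.nil : Quiver.Path i i)

/-- The coefficient of the trivial path at `i`, as a linear map. -/
noncomputable def augₗ (i : Q) : PathAlgebra k Q →ₗ[k] k :=
  Finsupp.lapply (⟨i, i, Quiver.Path.nil⟩ : Quiver.AllPaths Q)

open Classical in
theorem augₗ_ofPath (i : Q) {a b : Q} (p : Quiver.Path a b) :
    augₗ i (ofPath k p) =
      if (⟨a, b, p⟩ : Quiver.AllPaths Q) = ⟨i, i, Quiver.Path.nil⟩ then 1 else 0 :=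
  Finsupp.single_apply

theorem augₗ_mul (i : Q) (x y : PathAlgebra k Q) : augₗ i (x * y) = augₗ i x * augₗ i y := by
  classical
  have key : (mulₗ k Q).compr₂ (augₗ i) =
      (LinearMap.mul k k).compl₁₂ (augₗ (k := k) i) (augₗ i) := by
    refine hom_ext fun a b p => hom_ext fun c d q => ?_
    change augₗ i (ofPath k p * ofPath k q) = augₗ i (ofPath k p) * augₗ i (ofPath k q)
    by_cases h : b = c
    · subst h
      rw [ofPath_mul_ofPath, augₗ_ofPath, augₗ_ofPath, augₗ_ofPath]
      cases q with
      | nil =>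
        by_cases hb : b = i
        · subst hb; simp
        · have h1 : (⟨a, b, p⟩ : Quiver.AllPaths Q) ≠ ⟨i, i, Quiver.Path.nil⟩ := by
            rintro h; cases h; exact hb rfl
          simp [h1]
      | cons q e =>
        have h1 : ∀ (a b c : Q) (p : Quiver.Path a b) (e : b ⟶ c),
            (⟨a, c, p.cons e⟩ : Quiver.AllPaths Q) ≠ ⟨i, i, Quiver.Path.nil⟩ := by
          intro a b c p e h
          have := congrArg (fun s : Quiver.AllPaths Q => s.2.2.length) h
          simp at this
        rw [Quiver.Path.comp_cons, if_neg (h1 _ _ _ _ _), if_neg (h1 _ _ _ _ _), mul_zero]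
    · rw [ofPath_mul_ofPath_of_ne _ _ h, map_zero, augₗ_ofPath, augₗ_ofPath]
      by_cases hb : b = i
      · have h1 : (⟨c, d, q⟩ : Quiver.AllPaths Q) ≠ ⟨i, i, Quiver.Path.nil⟩ := by
          rintro h'; cases h'; exact h hb
        rw [if_neg h1, mul_zero]
      · have h1 : (⟨a, b, p⟩ : Quiver.AllPaths Q) ≠ ⟨i, i, Quiver.Path.nil⟩ := by
          rintro h'; cases h'; exact hb rfl
        rw [if_neg h1, zero_mul]
  exact LinearMap.congr_fun (LinearMap.congr_fun key x) y

/-- The algebra homomorphism `kQ → k` sending the trivial path at `i` to `1` and every other path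
to `0`. -/
noncomputable def aug (i : Q) : PathAlgebra k Q →ₐ[k] k :=
  AlgHom.ofLinearMap (augₗ i)
    (by
      classical
      rw [one_def, map_sum, Finset.sum_eq_single i]
      · rw [augₗ_ofPath, if_pos rfl]
      · intro b _ hb
        rw [augₗ_ofPath, if_neg]
        rintro h; cases h; exact hb rfl
      · simp)
    (augₗ_mul i)

theorem aug_surjective (i : Q) : Function.Surjective (aug (k := k) i) := fun c =>
  ⟨algebraMap k _ c, (aug (k := k) i).commutes c⟩

variable (k)

/-- The indecomposable projective right module `P i = e_i kQ`, the projective cover of the simple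
module supported at `i`. It has the paths starting at `i` as a basis. -/
noncomputable def projectiveModule (i : Q) : RightMod (PathAlgebra k Q) :=
  FGModuleCat.of (PathAlgebra k Q)ᵐᵒᵖ
    (Submodule.span (PathAlgebra k Q)ᵐᵒᵖ ({idem k i} : Set (PathAlgebra k Q)))

/-- The simple right module `S i` supported at the vertex `i`: the one-dimensional vector space on
which the trivial path at `i` acts as the identity and every other path as zero. -/
noncomputable def simpleModule (i : Q) : RightMod (PathAlgebra k Q) :=
  FGModuleCat.inflate (RingHom.op (aug (k := k) i).toRingHom)
    (fun c => (aug_surjective i c.unop).imp' op fun _ h => congrArg op h)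
    (FGModuleCat.of kᵐᵒᵖ k)

end PathAlgebra

end PathAlgebra

/-! ### The linearly oriented quiver of type `A_n` -/

/-- The vertex set of the quiver `1 → 2 → ⋯ → n`. The vertex labelled `i + 1` is `⟨i, _⟩`. -/
def LinearQuiver (n : ℕ) : Type := Fin n

namespace LinearQuiver

instance (n : ℕ) : Fintype (LinearQuiver n) := inferInstanceAs (Fintype (Fin n))

/-- There is precisely one arrow from each vertex to the next one, and no other arrow. -/
instance (n : ℕ) : Quiver.{0} (LinearQuiver n) where
  Hom a b := PLift (a.val + 1 = b.val)

/-- The vertex with label `i` (counted from `1`). -/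
def vertex {n : ℕ} (i : ℕ) (h : 1 ≤ i ∧ i ≤ n) : LinearQuiver n := ⟨i - 1, by omega⟩

theorem path_length {n : ℕ} {a b : LinearQuiver n} (p : Quiver.Path a b) :
    a.val + p.length = b.val := by
  induction p with
  | nil => rfl
  | cons p e ih => rw [← e.down, ← ih, Quiver.Path.length_cons, Nat.add_assoc]

instance {n : ℕ} (a b : LinearQuiver n) : Subsingleton (Quiver.Path a b) where
  allEq p q := by
    induction p with
    | nil =>
      cases q with
      | nil => rfl
      | cons q e =>
        have h1 := path_length q
        have h2 := e.down
        omega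
    | cons p e ih =>
      cases q with
      | nil =>
        have h1 := path_length p
        have h2 := e.down
        omega
      | @cons c _ q e' =>
        rename_i b' _
        have hbc : b' = c := Fin.ext (by have := e.down; have := e'.down; omega)
        subst hbc
        obtain ⟨e⟩ := e
        obtain ⟨e'⟩ := e'
        rw [ih q]

instance (n : ℕ) : Finite (Quiver.AllPaths (LinearQuiver n)) :=
  inferInstanceAs (Finite (Σ a b : LinearQuiver n, Quiver.Path a b))

end LinearQuiver

section Notions

variable (k : Type u) [Field k] (n : ℕ)

/-- The trivial extension `T(kQ_n)`. -/
abbrev TKQ : Type u := TrivialExtension k (PathAlgebra k (LinearQuiver n))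

/-- `P_i` as a `T(kQ_n)`-module. -/
noncomputable abbrev Pmod (i : ℕ) (h : 1 ≤ i ∧ i ≤ n) : RightMod (TKQ k n) :=
  TrivialExtension.inflate k _ (PathAlgebra.projectiveModule k (LinearQuiver.vertex i h))

/-- `S_i` as a `T(kQ_n)`-module. -/
noncomputable abbrev Smod (i : ℕ) (h : 1 ≤ i ∧ i ≤ n) : RightMod (TKQ k n) :=
  TrivialExtension.inflate k _ (PathAlgebra.simpleModule k (LinearQuiver.vertex i h))

end Notions

/-! In T(kQ_n) the functional reading off the coefficient of the longest path 1 → n acts as an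
additional arrow n → 1. This makes T(kQ_n) the path algebra of the cyclic quiver with n vertices
modulo the paths of length n + 1, a self-injective Nakayama algebra (`nakayamaData`). Every module
is a direct sum of uniserial modules (`isDirectSumOf_uniserial`). A uniserial module is determined
by its top i in ℤ/n and its length l ≤ n + 1, and those of length n + 1 are projective.

A map out of the uniserial module (i, l) is the choice of an element at the vertex i killed by the
l-th power of the sum of arrows, and the syzygy of (i, l) is (i + l, n + 1 - l). Hence Ext¹ between
uniserial modules vanishes under an explicit numerical condition, `ExtVanishes`, and higher Ext
follows by dimension shift (`subsingleton_ext_iff`). Being cluster-tilting becomes a statement about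
a set of pairs (i, l) (`isClusterTilting_of_nonprojective`).

For the first claim, P_n is the simple module (-1, 1). Since Ω² moves the top by one, the vanishing
of Ext in degrees 1 to 2n - 2 excludes all but one vertex for the top, and all but one for the end
of the module, which leaves (-1, 1) only. The other two claims are finite checks. In the third, the
syzygies Ω^{3i} yield eight pairs.

No Krull–Schmidt theorem is used: X lies in the additive closure of a class exactly when 𝟙 X lies in
the ideal `factorIdeal` of that class, and all comparisons of objects are made there. Since syzygies
matter only up to projective summands, the class of projectives is joined to the ideal
(`id_mem_factorIdeal_syzygy`). -/

/-! ### The ideal of morphisms factoring through a class of objects -/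

section FactorIdeal

variable {C : Type u} [Category.{v} C] [Preadditive C]

/-- The sums of morphisms `X ⟶ Y` that factor through an object of `𝒢`. -/
def factorIdeal (𝒢 : ObjectProperty C) (X Y : C) : AddSubgroup (X ⟶ Y) :=
  AddSubgroup.closure {h | ∃ G, 𝒢 G ∧ ∃ (f : X ⟶ G) (g : G ⟶ Y), f ≫ g = h}

variable {𝒢 ℋ : ObjectProperty C}

theorem comp_mem_factorIdeal {X G Y : C} (hG : 𝒢 G) (f : X ⟶ G) (g : G ⟶ Y) :
    f ≫ g ∈ factorIdeal 𝒢 X Y :=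
  AddSubgroup.subset_closure ⟨G, hG, f, g, rfl⟩

theorem id_mem_factorIdeal {G : C} (hG : 𝒢 G) : 𝟙 G ∈ factorIdeal 𝒢 G G := by
  simpa using comp_mem_factorIdeal hG (𝟙 G) (𝟙 G)

theorem factorIdeal_comp_left {X Y Z : C} (f : X ⟶ Y) {h : Y ⟶ Z}
    (hh : h ∈ factorIdeal 𝒢 Y Z) : f ≫ h ∈ factorIdeal 𝒢 X Z := by
  induction hh using AddSubgroup.closure_induction with
  | mem h hh =>
    obtain ⟨G, hG, a, b, rfl⟩ := hh
    rw [← Category.assoc]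
    exact comp_mem_factorIdeal hG _ _
  | zero => rw [comp_zero]; exact zero_mem _
  | add x y _ _ hx hy => rw [Preadditive.comp_add]; exact add_mem hx hy
  | neg x _ hx => rw [Preadditive.comp_neg]; exact neg_mem hx

theorem factorIdeal_comp_right {X Y Z : C} {h : X ⟶ Y} (hh : h ∈ factorIdeal 𝒢 X Y)
    (f : Y ⟶ Z) : h ≫ f ∈ factorIdeal 𝒢 X Z := by
  induction hh using AddSubgroup.closure_induction with
  | mem h hh =>
    obtain ⟨G, hG, a, b, rfl⟩ := hh
    rw [Category.assoc]
    exact comp_mem_factorIdeal hG _ _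
  | zero => rw [zero_comp]; exact zero_mem _
  | add x y _ _ hx hy => rw [Preadditive.add_comp]; exact add_mem hx hy
  | neg x _ hx => rw [Preadditive.neg_comp]; exact neg_mem hx

/-- It suffices to test identities of generating objects, because 𝟙 G can be inserted in the middle
of every factorisation through G. -/
theorem factorIdeal_trans (h𝒢 : ∀ G, 𝒢 G → 𝟙 G ∈ factorIdeal ℋ G G) {X Y : C} {h : X ⟶ Y}
    (hh : h ∈ factorIdeal 𝒢 X Y) : h ∈ factorIdeal ℋ X Y := by
  induction hh using AddSubgroup.closure_induction with
  | mem h hh =>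
    obtain ⟨G, hG, a, b, rfl⟩ := hh
    rw [← Category.id_comp b]
    exact factorIdeal_comp_left a (factorIdeal_comp_right (h𝒢 G hG) b)
  | zero => exact zero_mem _
  | add x y _ _ hx hy => exact add_mem hx hy
  | neg x _ hx => exact neg_mem hx

theorem id_mem_factorIdeal_of_comp_eq_id {X G : C} (hG : 𝟙 G ∈ factorIdeal 𝒢 G G)
    (s : X ⟶ G) (r : G ⟶ X) (h : s ≫ r = 𝟙 X) : 𝟙 X ∈ factorIdeal 𝒢 X X := by
  have := factorIdeal_comp_left s (factorIdeal_comp_right hG r)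
  rwa [Category.id_comp, h] at this

theorem id_mem_factorIdeal_biprod [HasBinaryBiproducts C] {X Y : C}
    (hX : 𝟙 X ∈ factorIdeal 𝒢 X X)
    (hY : 𝟙 Y ∈ factorIdeal 𝒢 Y Y) : 𝟙 (X ⊞ Y) ∈ factorIdeal 𝒢 (X ⊞ Y) (X ⊞ Y) := by
  rw [← biprod.total]
  refine add_mem ?_ ?_
  · simpa using factorIdeal_comp_left biprod.fst (factorIdeal_comp_right hX biprod.inl)
  · simpa using factorIdeal_comp_left biprod.snd (factorIdeal_comp_right hY biprod.inr)

theorem id_mem_factorIdeal_of_biprod_left [HasBinaryBiproducts C] {X Y : C}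
    (h : 𝟙 (X ⊞ Y) ∈ factorIdeal 𝒢 (X ⊞ Y) (X ⊞ Y)) : 𝟙 X ∈ factorIdeal 𝒢 X X :=
  id_mem_factorIdeal_of_comp_eq_id h biprod.inl biprod.fst biprod.inl_fst

theorem id_mem_factorIdeal_of_biprod_right [HasBinaryBiproducts C] {X Y : C}
    (h : 𝟙 (X ⊞ Y) ∈ factorIdeal 𝒢 (X ⊞ Y) (X ⊞ Y)) : 𝟙 Y ∈ factorIdeal 𝒢 Y Y :=
  id_mem_factorIdeal_of_comp_eq_id h biprod.inr biprod.snd biprod.inr_snd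

theorem id_mem_factorIdeal_biproduct [HasFiniteBiproducts C] {ι : Type} [Finite ι] (N : ι → C)
    (hN : ∀ i, 𝟙 (N i) ∈ factorIdeal 𝒢 (N i) (N i)) : 𝟙 (⨁ N) ∈ factorIdeal 𝒢 (⨁ N) (⨁ N) := by
  have := Fintype.ofFinite ι
  rw [← biproduct.total]
  refine sum_mem fun i _ => ?_
  simpa using factorIdeal_comp_left (biproduct.π N i)
    (factorIdeal_comp_right (hN i) (biproduct.ι N i))

theorem id_mem_factorIdeal_of_biproduct [HasFiniteBiproducts C] {ι : Type} [Finite ι] (N : ι → C)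
    (h : 𝟙 (⨁ N) ∈ factorIdeal 𝒢 (⨁ N) (⨁ N)) (i : ι) :
    𝟙 (N i) ∈ factorIdeal 𝒢 (N i) (N i) :=
  id_mem_factorIdeal_of_comp_eq_id h (biproduct.ι N i) (biproduct.π N i)
    (biproduct.ι_π_self N i)

theorem exists_sum_of_mem_factorIdeal_eq {M X Y : C} {h : X ⟶ Y}
    (hh : h ∈ factorIdeal (· = M) X Y) :
    ∃ (m : ℕ) (f : Fin m → (X ⟶ M)) (g : Fin m → (M ⟶ Y)), ∑ i, f i ≫ g i = h := by
  induction hh using AddSubgroup.closure_induction with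
  | mem h hh =>
    obtain ⟨_, rfl, f, g, rfl⟩ := hh
    exact ⟨1, fun _ => f, fun _ => g, by simp⟩
  | zero => exact ⟨0, Fin.elim0, Fin.elim0, by simp⟩
  | add x y _ _ hx hy =>
    obtain ⟨m, f, g, rfl⟩ := hx
    obtain ⟨m', f', g', rfl⟩ := hy
    exact ⟨m + m', Fin.append f f', Fin.append g g', by simp [Fin.sum_univ_add]⟩
  | neg x _ hx =>
    obtain ⟨m, f, g, rfl⟩ := hx
    exact ⟨m, fun i => - f i, g, by simp⟩

end FactorIdeal

section AdditiveClosure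

variable {C : Type u} [Category.{v} C] [Abelian C]

/-- If `∑ i, f i ≫ g i = 𝟙 X`, then `biproduct.lift f` and `biproduct.desc g` exhibit X as a summand
of a power of M. -/
theorem additiveClosure_iff {M X : C} :
    additiveClosure M X ↔ 𝟙 X ∈ factorIdeal (· = M) X X := by
  constructor
  · rintro ⟨m, ⟨r⟩⟩
    exact id_mem_factorIdeal_of_comp_eq_id
      (id_mem_factorIdeal_biproduct _ fun _ => id_mem_factorIdeal rfl) r.i r.r r.retract
  · intro h
    obtain ⟨m, f, g, hfg⟩ := exists_sum_of_mem_factorIdeal_eq h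
    exact ⟨m, ⟨⟨biproduct.lift f, biproduct.desc g, by rw [biproduct.lift_desc, hfg]⟩⟩⟩

/-- `add M` is described by any class of objects generating the same ideal of morphisms. -/
theorem additiveClosure_iff_of_class {M : C} {𝒢 : ObjectProperty C}
    (hM : 𝟙 M ∈ factorIdeal 𝒢 M M) (h𝒢 : ∀ G, 𝒢 G → 𝟙 G ∈ factorIdeal (· = M) G G) {X : C} :
    additiveClosure M X ↔ 𝟙 X ∈ factorIdeal 𝒢 X X := by
  rw [additiveClosure_iff]
  exact ⟨factorIdeal_trans (by rintro _ rfl; exact hM), factorIdeal_trans h𝒢⟩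

/-- If all morphism groups from and to `M` are finitely generated over the endomorphism ring
of `M`, then `add M` is functorially finite. -/
theorem isFunctoriallyFinite_additiveClosure {M : C}
    (hr : ∀ X : C, ∃ (m : ℕ) (f : Fin m → (M ⟶ X)), ∀ g : M ⟶ X,
      ∃ c : Fin m → (M ⟶ M), ∑ i, c i ≫ f i = g)
    (hl : ∀ X : C, ∃ (m : ℕ) (f : Fin m → (X ⟶ M)), ∀ g : X ⟶ M,
      ∃ c : Fin m → (M ⟶ M), ∑ i, f i ≫ c i = g) :
    IsFunctoriallyFinite (additiveClosure M) := by
  have hadd (m : ℕ) : additiveClosure M (⨁ fun _ : Fin m => M) := ⟨m, ⟨Retract.refl _⟩⟩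
  constructor
  · intro X
    obtain ⟨m, f, hf⟩ := hr X
    refine ⟨_, biproduct.desc f, hadd m, fun V hV g => ?_⟩
    -- As V is a summand of a power of M, `g` equals `∑ i, s i ≫ t i ≫ g`, and each `t i ≫ g` starts
    -- at M, where the finite generation applies.
    obtain ⟨p, s, t, hst⟩ := exists_sum_of_mem_factorIdeal_eq (additiveClosure_iff.1 hV)
    choose c hc using fun i => hf (t i ≫ g)
    refine ⟨∑ i, s i ≫ biproduct.lift (c i), ?_⟩
    simp only [Preadditive.sum_comp, Category.assoc, biproduct.lift_desc, hc]
    simp only [← Category.assoc, ← Preadditive.sum_comp, hst, Category.id_comp]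
  · intro X
    obtain ⟨m, f, hf⟩ := hl X
    refine ⟨_, biproduct.lift f, hadd m, fun V hV g => ?_⟩
    obtain ⟨p, s, t, hst⟩ := exists_sum_of_mem_factorIdeal_eq (additiveClosure_iff.1 hV)
    choose c hc using fun i => hf (g ≫ s i)
    refine ⟨∑ i, biproduct.desc (c i) ≫ t i, ?_⟩
    simp only [Preadditive.comp_sum, biproduct.lift_desc_assoc, hc]
    simp only [Category.assoc, ← Preadditive.comp_sum, hst, Category.comp_id]

end AdditiveClosure

/-! ### Vanishing of extension groups -/

section ExtVanishing

variable {C : Type u} [Category.{v} C] [Abelian C] [HasExt.{w} C]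

/-- The endomorphisms of X acting as zero on Ext(X, Y) form a subgroup containing every map that
factors through 𝒢. Once it contains the identity, the group vanishes. -/
theorem subsingleton_ext_of_left {𝒢 : ObjectProperty C} {X Y : C} {i : ℕ}
    (hX : 𝟙 X ∈ factorIdeal 𝒢 X X) (h : ∀ G, 𝒢 G → Subsingleton (Ext.{w} G Y i)) :
    Subsingleton (Ext.{w} X Y i) := by
  suffices ∀ f : X ⟶ X, f ∈ factorIdeal 𝒢 X X → ∀ α : Ext.{w} X Y i,
      (Ext.mk₀ f).comp α (zero_add i) = 0 from
    subsingleton_of_forall_eq 0 fun α => by simpa using this _ hX α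
  intro f hf α
  induction hf using AddSubgroup.closure_induction with
  | mem f hf =>
    obtain ⟨G, hG, a, b, rfl⟩ := hf
    have := h G hG
    rw [← Ext.mk₀_comp_mk₀_assoc, Subsingleton.elim ((Ext.mk₀ b).comp α (zero_add i)) 0,
      Ext.comp_zero]
  | zero => rw [Ext.mk₀_zero, Ext.zero_comp]
  | add x y _ _ hx hy => rw [Ext.mk₀_add, Ext.add_comp, hx, hy, add_zero]
  | neg x _ hx => rw [Ext.mk₀_neg, Ext.neg_comp, hx, neg_zero]

theorem subsingleton_ext_of_right {𝒢 : ObjectProperty C} {X Y : C} {i : ℕ}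
    (hY : 𝟙 Y ∈ factorIdeal 𝒢 Y Y) (h : ∀ G, 𝒢 G → Subsingleton (Ext.{w} X G i)) :
    Subsingleton (Ext.{w} X Y i) := by
  suffices ∀ f : Y ⟶ Y, f ∈ factorIdeal 𝒢 Y Y → ∀ α : Ext.{w} X Y i,
      α.comp (Ext.mk₀ f) (add_zero i) = 0 from
    subsingleton_of_forall_eq 0 fun α => by simpa using this _ hY α
  intro f hf α
  induction hf using AddSubgroup.closure_induction with
  | mem f hf =>
    obtain ⟨G, hG, a, b, rfl⟩ := hf
    have := h G hG
    rw [← Ext.mk₀_comp_mk₀, ← Ext.comp_assoc_of_third_deg_zero,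
      Subsingleton.elim (α.comp (Ext.mk₀ a) (add_zero i)) 0, Ext.zero_comp]
  | zero => rw [Ext.mk₀_zero, Ext.comp_zero]
  | add x y _ _ hx hy => rw [Ext.mk₀_add, Ext.comp_add, hx, hy, add_zero]
  | neg x _ hx => rw [Ext.mk₀_neg, Ext.comp_neg, hx, neg_zero]

theorem subsingleton_ext_retract_left {X X' Y : C} {i : ℕ} (s : X' ⟶ X) (r : X ⟶ X')
    (hsr : s ≫ r = 𝟙 X') (h : Subsingleton (Ext.{w} X Y i)) : Subsingleton (Ext.{w} X' Y i) :=
  subsingleton_ext_of_left (𝒢 := (· = X))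
    (id_mem_factorIdeal_of_comp_eq_id (id_mem_factorIdeal rfl) s r hsr) (by rintro _ rfl; exact h)

theorem subsingleton_ext_retract_right {X Y Y' : C} {i : ℕ} (s : Y' ⟶ Y) (r : Y ⟶ Y')
    (hsr : s ≫ r = 𝟙 Y') (h : Subsingleton (Ext.{w} X Y i)) : Subsingleton (Ext.{w} X Y' i) :=
  subsingleton_ext_of_right (𝒢 := (· = Y))
    (id_mem_factorIdeal_of_comp_eq_id (id_mem_factorIdeal rfl) s r hsr) (by rintro _ rfl; exact h)

variable {S : ShortComplex C} (hS : S.ShortExact) [Projective S.X₂] (Y : C)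
include hS

/-- By the long exact sequence and projectivity of the middle term, Ext¹(X₃, Y) is the cokernel of
Hom(X₂, Y) → Hom(X₁, Y). -/
theorem subsingleton_ext_one_iff :
    Subsingleton (Ext.{w} S.X₃ Y 1) ↔ ∀ f : S.X₁ ⟶ Y, ∃ g : S.X₂ ⟶ Y, S.f ≫ g = f := by
  constructor
  · intro h f
    obtain ⟨x, hx⟩ := Ext.contravariant_sequence_exact₁ hS Y (Ext.mk₀ f) (add_zero 1)
      (Subsingleton.elim _ _)
    obtain ⟨g, rfl⟩ := Ext.mk₀_bijective _ _ |>.surjective x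
    exact ⟨g, Ext.mk₀_bijective _ _ |>.injective (by rw [← hx, Ext.mk₀_comp_mk₀])⟩
  · intro h
    refine subsingleton_of_forall_eq 0 fun α => ?_
    obtain ⟨x, rfl⟩ := Ext.contravariant_sequence_exact₃ hS Y α (Ext.eq_zero_of_projective _)
      (n₀ := 0) (add_zero 1)
    obtain ⟨f, rfl⟩ := Ext.mk₀_bijective _ _ |>.surjective x
    obtain ⟨g, rfl⟩ := h f
    rw [← Ext.mk₀_comp_mk₀, hS.extClass_comp_assoc]

/-- Dimension shift along a projective middle term. -/
theorem subsingleton_ext_succ_iff (i : ℕ) :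
    Subsingleton (Ext.{w} S.X₃ Y (i + 2)) ↔ Subsingleton (Ext.{w} S.X₁ Y (i + 1)) := by
  constructor
  · intro h
    refine subsingleton_of_forall_eq 0 fun α => ?_
    obtain ⟨x, rfl⟩ := Ext.contravariant_sequence_exact₁ hS Y α (n₁ := i + 2) (by omega)
      (Subsingleton.elim _ _)
    rw [Ext.eq_zero_of_projective x, Ext.comp_zero]
  · intro h
    refine subsingleton_of_forall_eq 0 fun α => ?_
    obtain ⟨x, rfl⟩ := Ext.contravariant_sequence_exact₃ hS Y α (Ext.eq_zero_of_projective _)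
      (n₀ := i + 1) (by omega)
    rw [Subsingleton.elim x 0, Ext.comp_zero]

end ExtVanishing

/-! ### Cluster-tilting from a decomposition into indecomposable objects -/

section Criterion

variable {C : Type u} [Category.{v} C] [Abelian C]

/-- `X` is a finite direct sum of objects of `𝒟`: its identity is a sum of idempotents that split
through objects of `𝒟`. -/
def IsDirectSumOf (𝒟 : ObjectProperty C) (X : C) : Prop :=
  𝟙 X ∈ AddSubgroup.closure {h : X ⟶ X | ∃ G, 𝒟 G ∧ ∃ (r : X ⟶ G) (s : G ⟶ X),
    s ≫ r = 𝟙 G ∧ r ≫ s = h}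

/-- Since the idempotents split, each G that occurs is a retract of X and inherits Ext-vanishing
from it. A mere factorisation through G would not give this. -/
theorem IsDirectSumOf.id_mem_factorIdeal {𝒟 𝒢 : ObjectProperty C} {X : C}
    (hX : IsDirectSumOf 𝒟 X)
    (h : ∀ G, 𝒟 G → ∀ (s : G ⟶ X) (r : X ⟶ G), s ≫ r = 𝟙 G → 𝟙 G ∈ factorIdeal 𝒢 G G) :
    𝟙 X ∈ factorIdeal 𝒢 X X := by
  refine (AddSubgroup.closure_le _).2 ?_ hX
  rintro _ ⟨G, hG, r, s, hsr, rfl⟩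
  simpa using factorIdeal_comp_left r (factorIdeal_comp_right (h G hG s r hsr) s)

/-- Cluster-tilting can be checked on indecomposable objects: it suffices that every object is a
direct sum of objects of `𝒟`, and that the vanishing of extension groups characterizes the class
`𝒢` among the objects of `𝒟`. -/
theorem isClusterTilting_additiveClosure [HasExt.{w} C] {d : ℕ} {M : C} {𝒟 𝒢 : ObjectProperty C}
    (hfin : IsFunctoriallyFinite (additiveClosure M))
    (h𝒟 : ∀ X, IsDirectSumOf 𝒟 X)
    (hM : 𝟙 M ∈ factorIdeal 𝒢 M M) (h𝒢 : ∀ G, 𝒢 G → 𝟙 G ∈ factorIdeal (· = M) G G)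
    (hext : ∀ G H, 𝒢 G → 𝒢 H → ∀ i, 1 ≤ i → i + 1 ≤ d → Subsingleton (Ext.{w} G H i))
    (hleft : ∀ X, 𝒟 X → (∀ G, 𝒢 G → ∀ i, 1 ≤ i → i + 1 ≤ d → Subsingleton (Ext.{w} X G i)) →
      𝒢 X)
    (hright : ∀ X, 𝒟 X → (∀ G, 𝒢 G → ∀ i, 1 ≤ i → i + 1 ≤ d → Subsingleton (Ext.{w} G X i)) →
      𝒢 X) :
    IsClusterTilting.{w} d (additiveClosure M) := by
  have hadd (X : C) := additiveClosure_iff_of_class hM h𝒢 (X := X)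
  have hG (G : C) (h : 𝒢 G) : additiveClosure M G := (hadd G).2 (id_mem_factorIdeal h)
  refine ⟨hfin, fun X => ⟨fun hX U hU i h1 hi => ?_, fun h => ?_⟩,
    fun X => ⟨fun hX U hU i h1 hi => ?_, fun h => ?_⟩⟩
  · exact subsingleton_ext_of_left ((hadd X).1 hX) fun G hG =>
      subsingleton_ext_of_right ((hadd U).1 hU) fun H hH => hext G H hG hH i h1 hi
  · exact (hadd X).2 ((h𝒟 X).id_mem_factorIdeal fun G hG' s r hsr => id_mem_factorIdeal
      (hleft G hG' fun H hH i h1 hi => subsingleton_ext_retract_left s r hsr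
        (h H (hG H hH) i h1 hi)))
  · exact subsingleton_ext_of_left ((hadd U).1 hU) fun G hG =>
      subsingleton_ext_of_right ((hadd X).1 hX) fun H hH => hext G H hG hH i h1 hi
  · exact (hadd X).2 ((h𝒟 X).id_mem_factorIdeal fun G hG' s r hsr => id_mem_factorIdeal
      (hright G hG' fun H hH i h1 hi => subsingleton_ext_retract_right s r hsr
        (h H (hG H hH) i h1 hi)))

end Criterion

/-! ### Syzygies -/

section Syzygies

variable {C : Type u} [Category.{v} C] [Abelian C]

/-- The class of first syzygies, together with all projective objects, is determined by the
original class up to direct summands. -/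
theorem id_mem_factorIdeal_syzygy {𝒢 𝒢' : ObjectProperty C}
    (h𝒢 : ∀ G, 𝒢 G → ∃ S : ShortComplex C, S.ShortExact ∧ Projective S.X₂ ∧ S.X₃ = G ∧ 𝒢' S.X₁)
    {S : ShortComplex C} (hS : S.ShortExact) [Projective S.X₂]
    (h : 𝟙 S.X₃ ∈ factorIdeal (𝒢 ⊔ isProjective C) S.X₃ S.X₃) :
    𝟙 S.X₁ ∈ factorIdeal (𝒢' ⊔ isProjective C) S.X₁ S.X₁ := by
  have := hS.mono_f
  have := hS.epi_g
  have lift {T : ShortComplex C} (hT : T.ShortExact) {A : C} (t : A ⟶ T.X₂) (ht : t ≫ T.g = 0) :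
      ∃ t', t' ≫ T.f = t :=
    have := hT.mono_f
    ⟨hT.exact.lift t ht, hT.exact.lift_f t ht⟩
  -- Every endomorphism in the ideal lifts to the whole short exact sequence with its left component
  -- again in the ideal. For the identity, `f₂ - 𝟙` lands in the kernel of `S.g`, so `f₁` differs
  -- from the identity by a map through the projective `S.X₂`.
  suffices ∀ f : S.X₃ ⟶ S.X₃, f ∈ factorIdeal (𝒢 ⊔ isProjective C) S.X₃ S.X₃ →
      ∃ f₁ ∈ factorIdeal (𝒢' ⊔ isProjective C) S.X₁ S.X₁, ∃ f₂ : S.X₂ ⟶ S.X₂,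
        S.f ≫ f₂ = f₁ ≫ S.f ∧ f₂ ≫ S.g = S.g ≫ f by
    obtain ⟨f₁, hf₁, f₂, h₁, h₂⟩ := this _ h
    obtain ⟨t, ht⟩ := lift hS (f₂ - 𝟙 _) (by simp [h₂])
    have : 𝟙 S.X₁ = f₁ - S.f ≫ t := by
      rw [← cancel_mono S.f, Preadditive.sub_comp, Category.assoc, ht, Preadditive.comp_sub, h₁]
      simp
    rw [this]
    exact sub_mem hf₁ (comp_mem_factorIdeal (𝒢 := 𝒢' ⊔ isProjective C) (Or.inr ‹Projective S.X₂›) _ _)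
  intro f hf
  induction hf using AddSubgroup.closure_induction with
  | mem f hf =>
    obtain ⟨G, hG | hG, a, b, rfl⟩ := hf
    · obtain ⟨S', hS', hP, rfl, hG'⟩ := h𝒢 G hG
      have := hS'.epi_g
      let a₂ := Projective.factorThru (S.g ≫ a) S'.g
      have ha₂ : a₂ ≫ S'.g = S.g ≫ a := Projective.factorThru_comp _ _
      let b₂ := Projective.factorThru (S'.g ≫ b) S.g
      have hb₂ : b₂ ≫ S.g = S'.g ≫ b := Projective.factorThru_comp _ _
      obtain ⟨a₁, ha₁⟩ := lift hS' (S.f ≫ a₂) (by rw [Category.assoc, ha₂, S.zero_assoc, zero_comp])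
      obtain ⟨b₁, hb₁⟩ := lift hS (S'.f ≫ b₂) (by rw [Category.assoc, hb₂, S'.zero_assoc, zero_comp])
      refine ⟨_, comp_mem_factorIdeal (𝒢 := 𝒢' ⊔ isProjective C) (Or.inl hG') a₁ b₁, a₂ ≫ b₂, ?_, ?_⟩
      · rw [Category.assoc, hb₁, reassoc_of% ha₁]
      · rw [Category.assoc, hb₂, reassoc_of% ha₂]
    -- A map through a projective lifts along `S.g`, so the left component may be taken to be zero.
    · have : Projective G := hG
      refine ⟨0, zero_mem _, S.g ≫ a ≫ Projective.factorThru b S.g, by simp, by simp⟩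
  | zero => exact ⟨0, zero_mem _, 0, by simp, by simp⟩
  | add x y _ _ hx hy =>
    obtain ⟨x₁, hx₁, x₂, h₁, h₂⟩ := hx
    obtain ⟨y₁, hy₁, y₂, h₃, h₄⟩ := hy
    exact ⟨x₁ + y₁, add_mem hx₁ hy₁, x₂ + y₂, by simp [h₁, h₃], by simp [h₂, h₄]⟩
  | neg x _ hx =>
    obtain ⟨x₁, hx₁, x₂, h₁, h₂⟩ := hx
    exact ⟨-x₁, neg_mem hx₁, -x₂, by simp [h₁], by simp [h₂]⟩

end Syzygies

/-! ### Self-injective Nakayama algebras with `n` simples and Loewy length `n + 1` -/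

/-- A presentation of the algebra `R` as the path algebra of the cyclic quiver with `n` vertices
modulo the paths of length `n + 1`: the idempotents `e i` of the vertices and the sum `a` of all
arrows. Left multiplication by `a` goes from the vertex `i` to the vertex `i + 1`. -/
structure NakayamaData (k R : Type*) [Field k] [Ring R] [Algebra k R] (n : ℕ) [NeZero n] where
  e : ZMod n → R
  a : R
  e_mul_e_self : ∀ i, e i * e i = e i
  e_mul_e_of_ne : ∀ {i j}, i ≠ j → e i * e j = 0
  sum_e : ∑ i, e i = 1
  a_mul_e : ∀ i, a * e i = e (i + 1) * a
  a_pow : a ^ (n + 1) = 0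
  a_pow_mul_e_ne : ∀ i, a ^ n * e i ≠ 0
  span_eq_top : Submodule.span k (Set.range fun p : ℕ × ZMod n => a ^ p.1 * e p.2) = ⊤

namespace NakayamaData

variable {k R : Type*} [Field k] [Ring R] [Algebra k R] {n : ℕ} [NeZero n]
  (D : NakayamaData k R n)

section Basic

theorem a_pow_mul_e (j : ℕ) (i : ZMod n) : D.a ^ j * D.e i = D.e (i + j) * D.a ^ j := by
  induction j generalizing i with
  | zero => simp
  | succ j ih =>
    rw [pow_succ, mul_assoc, D.a_mul_e, ← mul_assoc, ih, mul_assoc]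
    congr 2
    push_cast
    ring

theorem a_pow_eq_zero {j : ℕ} (hj : n + 1 ≤ j) : D.a ^ j = 0 := by
  obtain ⟨t, rfl⟩ := Nat.exists_eq_add_of_le hj
  rw [pow_add, D.a_pow, zero_mul]

/-- Orthogonality removes the paths starting at other vertices, and `D.a ^ (n + 1) = 0` removes the
long ones. -/
theorem exists_mul_e_eq (r : R) (i : ZMod n) :
    ∃ c : ℕ → k, r * D.e i = ∑ j ∈ Finset.range (n + 1), c j • (D.a ^ j * D.e i) := by
  have hr : r ∈ Submodule.span k (Set.range fun p : ℕ × ZMod n => D.a ^ p.1 * D.e p.2) := by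
    rw [D.span_eq_top]; trivial
  induction hr using Submodule.span_induction with
  | mem x hx =>
    obtain ⟨⟨j, p⟩, rfl⟩ := hx
    by_cases hp : p = i
    · subst hp
      simp only [mul_assoc, D.e_mul_e_self]
      by_cases hj : j < n + 1
      · exact ⟨Pi.single j 1, by
          rw [Finset.sum_eq_single j]
          · simp
          · intro b _ hb
            simp [hb]
          · simp [hj]⟩
      · exact ⟨0, by simp [D.a_pow_eq_zero (not_lt.1 hj)]⟩
    · exact ⟨0, by simp [mul_assoc, D.e_mul_e_of_ne hp]⟩
  | zero => exact ⟨0, by simp⟩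
  | add x y _ _ hx hy =>
    obtain ⟨c, hc⟩ := hx
    obtain ⟨c', hc'⟩ := hy
    exact ⟨c + c', by simp [add_mul, hc, hc', add_smul, Finset.sum_add_distrib]⟩
  | smul t x _ hx =>
    obtain ⟨c, hc⟩ := hx
    exact ⟨t • c, by simp [hc, mul_smul, Finset.smul_sum]⟩

end Basic

section Modules

variable {X Y : Type*} [AddCommGroup X] [Module R X] [AddCommGroup Y] [Module R Y]

theorem e_smul_e_smul_of_ne {i j : ZMod n} (h : i ≠ j) (x : X) : D.e i • D.e j • x = 0 := by
  rw [smul_smul, D.e_mul_e_of_ne h, zero_smul]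

theorem e_smul_e_smul_self (i : ZMod n) (x : X) : D.e i • D.e i • x = D.e i • x := by
  rw [smul_smul, D.e_mul_e_self]

theorem sum_e_smul (x : X) : ∑ i, D.e i • x = x := by
  rw [← Finset.sum_smul, D.sum_e, one_smul]

theorem a_pow_smul_e_smul (j : ℕ) (i : ZMod n) (x : X) :
    D.a ^ j • D.e i • x = D.e (i + j) • D.a ^ j • x := by
  rw [smul_smul, D.a_pow_mul_e, mul_smul]

theorem a_smul_a_pow_smul (j : ℕ) (x : X) : D.a • D.a ^ j • x = D.a ^ (j + 1) • x := by
  rw [smul_smul, pow_succ']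

theorem a_pow_smul_a_pow_smul (i j : ℕ) (x : X) : D.a ^ i • D.a ^ j • x = D.a ^ (i + j) • x := by
  rw [smul_smul, pow_add]

theorem e_smul_a_pow_smul_self {x : X} {i : ZMod n} (hx : D.e i • x = x) {p : ZMod n} {j : ℕ}
    (h : i + j = p) : D.e p • D.a ^ j • x = D.a ^ j • x := by
  subst h
  rw [← D.a_pow_smul_e_smul, hx]

theorem e_smul_a_pow_smul_of_ne {x : X} {i : ZMod n} (hx : D.e i • x = x) {p : ZMod n} {j : ℕ}
    (h : i + j ≠ p) : D.e p • D.a ^ j • x = 0 := by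
  rw [← hx, D.a_pow_smul_e_smul, D.e_smul_e_smul_of_ne h.symm]

theorem a_pow_smul_eq_zero_of_le {x : X} {l j : ℕ} (hx : D.a ^ l • x = 0) (h : l ≤ j) :
    D.a ^ j • x = 0 := by
  obtain ⟨t, rfl⟩ := Nat.exists_eq_add_of_le' h
  rw [pow_add, mul_smul, hx, smul_zero]

/-- `X` is uniserial of length `l`, and `x` generates it and lies at the vertex `i`. -/
structure IsGenerator (x : X) (i : ZMod n) (l : ℕ) : Prop where
  e_smul : D.e i • x = x
  pow_smul : D.a ^ l • x = 0
  pow_smul_ne : ∀ j < l, D.a ^ j • x ≠ 0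
  span_eq_top : Submodule.span R {x} = ⊤

variable {D}

theorem IsGenerator.le {x : X} {i : ZMod n} {l : ℕ} (h : D.IsGenerator x i l) : l ≤ n + 1 := by
  by_contra hl
  exact h.pow_smul_ne (n + 1) (by omega) (by rw [D.a_pow, zero_smul])

theorem IsGenerator.exists_eq_smul {x : X} {i : ZMod n} {l : ℕ} (h : D.IsGenerator x i l) (z : X) : ∃ r : R, z = r • x := by
  have : z ∈ Submodule.span R {x} := by rw [h.span_eq_top]; trivial
  obtain ⟨r, rfl⟩ := Submodule.mem_span_singleton.1 this
  exact ⟨r, rfl⟩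

theorem IsGenerator.linearMap_ext {x : X} {i : ZMod n} {l : ℕ}
    (h : D.IsGenerator x i l) {f g : X →ₗ[R] Y} (hfg : f x = g x) : f = g := by
  ext z
  obtain ⟨r, rfl⟩ := h.exists_eq_smul z
  rw [map_smul, map_smul, hfg]

variable (D) [Module k X] [IsScalarTower k R X] [Module k Y] [IsScalarTower k R Y]

/-- Multiplying by `D.a ^ (l - 1 - j)` kills all terms above j, and those below j vanish by
induction. The sum may run past l, where coefficients are unconstrained. -/
theorem coeff_eq_zero {x : X} {l : ℕ} (hx : D.a ^ l • x = 0) (hx' : ∀ j < l, D.a ^ j • x ≠ 0)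
    {N : ℕ} {c : ℕ → k} (hc : ∑ j ∈ Finset.range N, c j • D.a ^ j • x = 0) (j : ℕ) (hjN : j < N)
    (hjl : j < l) : c j = 0 := by
  have : SMulCommClass R k X := IsScalarTower.to_smulCommClass'
  induction j using Nat.strong_induction_on with
  | _ j ih =>
    have h := congrArg (D.a ^ (l - 1 - j) • ·) hc
    simp only [Finset.smul_sum, smul_zero] at h
    rw [Finset.sum_eq_single j] at h
    · rw [smul_comm, D.a_pow_smul_a_pow_smul] at h
      exact (smul_eq_zero.1 h).resolve_right (hx' _ (by omega))
    · intro m hm hmj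
      rcases lt_or_gt_of_ne hmj with hlt | hgt
      · rw [ih m hlt (Finset.mem_range.1 hm) (by omega), zero_smul, smul_zero]
      · rw [smul_comm, D.a_pow_smul_a_pow_smul, D.a_pow_smul_eq_zero_of_le hx (by omega),
          smul_zero]
    · intro hj
      exact absurd (Finset.mem_range.2 hjN) hj

/-- The point is that the same coefficients serve both modules, so that annihilators of elements at
one vertex can be compared. -/
theorem exists_smul_eq (r : R) (i : ZMod n) : ∃ c : ℕ → k,
    (∀ x : X, D.e i • x = x → r • x = ∑ j ∈ Finset.range (n + 1), c j • D.a ^ j • x) ∧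
    (∀ y : Y, D.e i • y = y → r • y = ∑ j ∈ Finset.range (n + 1), c j • D.a ^ j • y) := by
  obtain ⟨c, hc⟩ := D.exists_mul_e_eq r i
  refine ⟨c, fun x hx => ?_, fun x hx => ?_⟩ <;>
  · rw [← hx, smul_smul, hc, Finset.sum_smul]
    simp only [smul_assoc, mul_smul]

/-- An additive map that is compatible with scalars, vertices and arrows is `R`-linear. -/
theorem map_smul_of_map_a_smul (f : X →ₗ[k] Y) (he : ∀ i x, f (D.e i • x) = D.e i • f x)
    (ha : ∀ x, f (D.a • x) = D.a • f x) (r : R) (x : X) : f (r • x) = r • f x := by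
  have hpow (j : ℕ) (x : X) : f (D.a ^ j • x) = D.a ^ j • f x := by
    induction j with
    | zero => simp
    | succ j ih => rw [← D.a_smul_a_pow_smul, ha, ih, D.a_smul_a_pow_smul]
  have hr : r ∈ Submodule.span k (Set.range fun p : ℕ × ZMod n => D.a ^ p.1 * D.e p.2) := by
    rw [D.span_eq_top]; trivial
  induction hr using Submodule.span_induction with
  | mem r hr =>
    obtain ⟨⟨j, p⟩, rfl⟩ := hr
    rw [mul_smul, hpow, he, mul_smul]
  | zero => simp
  | add r s _ _ hr hs => rw [add_smul, map_add, hr, hs, add_smul]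
  | smul c r _ hr => rw [smul_assoc, map_smul, hr, smul_assoc]

variable {D}

namespace IsGenerator

variable {x : X} {i : ZMod n} {l : ℕ} (h : D.IsGenerator x i l)
include h

theorem exists_eq_sum (z : X) :
    ∃ c : ℕ → k, z = ∑ j ∈ Finset.range (n + 1), c j • D.a ^ j • x := by
  obtain ⟨r, rfl⟩ := h.exists_eq_smul z
  obtain ⟨c, hc, -⟩ := D.exists_smul_eq (X := X) (Y := X) r i
  exact ⟨c, hc x h.e_smul⟩

/-- The annihilator of the generator x is contained in that of y, so r • x ↦ r • y is well defined.
-/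
theorem exists_linearMap {y : Y} (hy : D.e i • y = y) (hy' : D.a ^ l • y = 0) :
    ∃ f : X →ₗ[R] Y, f x = y := by
  have hsurj : Function.Surjective (LinearMap.toSpanSingleton R X x) := fun z => by
    obtain ⟨r, rfl⟩ := h.exists_eq_smul z
    exact ⟨r, rfl⟩
  have hker : LinearMap.ker (LinearMap.toSpanSingleton R X x) ≤
      LinearMap.ker (LinearMap.toSpanSingleton R Y y) := by
    intro r hr
    rw [LinearMap.mem_ker, LinearMap.toSpanSingleton_apply] at hr ⊢
    obtain ⟨c, hcx, hcy⟩ := D.exists_smul_eq (X := X) (Y := Y) r i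
    rw [hcx x h.e_smul] at hr
    rw [hcy y hy]
    refine Finset.sum_eq_zero fun j hj => ?_
    by_cases hjl : j < l
    · rw [D.coeff_eq_zero h.pow_smul h.pow_smul_ne hr j (Finset.mem_range.1 hj) hjl, zero_smul]
    · rw [D.a_pow_smul_eq_zero_of_le hy' (not_lt.1 hjl), smul_zero]
  refine ⟨(Submodule.liftQ _ _ hker) ∘ₗ
    (LinearMap.quotKerEquivOfSurjective _ hsurj).symm.toLinearMap, ?_⟩
  have hx : (LinearMap.quotKerEquivOfSurjective _ hsurj).symm x = Submodule.Quotient.mk 1 := by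
    rw [LinearEquiv.symm_apply_eq, LinearMap.quotKerEquivOfSurjective_apply_mk]
    simp
  simp [hx]

end IsGenerator

/-- A uniserial submodule of maximal length is a direct summand. -/
theorem exists_retraction {x : X} {i : ZMod n} {l : ℕ} (hl : 1 ≤ l) (hx : D.e i • x = x)
    (hx' : D.a ^ (l - 1) • x ≠ 0) (hX : ∀ z : X, D.a ^ l • z = 0)
    {y : Y} (hy : D.IsGenerator y i l) : ∃ f : X →ₗ[R] Y, f x = y := by
  have : SMulCommClass R k X := IsScalarTower.to_smulCommClass'
  have : SMulCommClass R k Y := IsScalarTower.to_smulCommClass'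
  have hne : ∀ j < l, D.a ^ j • x ≠ 0 := fun j hj h0 =>
    hx' (D.a_pow_smul_eq_zero_of_le h0 (by omega))
  have hindep : LinearIndependent k fun j : Fin l => D.a ^ (j : ℕ) • x := by
    rw [Fintype.linearIndependent_iff]
    intro g hg j
    have := D.coeff_eq_zero (hX x) hne (N := l)
      (c := fun j => if hj : j < l then g ⟨j, hj⟩ else 0)
      (by rw [Finset.sum_range]; simpa using hg) j j.2 j.2
    simpa using this
  -- A functional reading off the socle element `D.a ^ (l - 1) • x` and vanishing on the lower
  -- powers.
  obtain ⟨φ, hφ⟩ : ∃ φ : X →ₗ[k] k, ∀ j < l, φ (D.a ^ j • x) = if j = l - 1 then 1 else 0 := by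
    obtain ⟨g, hg⟩ := LinearMap.exists_leftInverse_of_injective _
      (LinearMap.ker_eq_bot.2 hindep.fintypeLinearCombination_injective)
    refine ⟨LinearMap.proj ⟨l - 1, by omega⟩ ∘ₗ g, fun j hj => ?_⟩
    have := congrFun (LinearMap.congr_fun hg (Pi.single ⟨j, hj⟩ 1)) ⟨l - 1, by omega⟩
    simp only [LinearMap.comp_apply, Fintype.linearCombination_apply_single, one_smul,
      LinearMap.id_apply] at this
    rw [LinearMap.comp_apply, LinearMap.proj_apply, this, Pi.single_apply]
    simp [Fin.ext_iff, eq_comm]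
  -- The coefficient of `D.a ^ j • y` is found by pushing the part of z at the vertex i + j down to
  -- socle level and applying `φ`. This turns a functional into a module map, as for a Frobenius
  -- form: Y is injective among modules killed by `D.a ^ l`.
  let f : X →ₗ[k] Y := ∑ j ∈ Finset.range l,
    (φ ∘ₗ DistribSMul.toLinearMap k X (D.a ^ (l - 1 - j) * D.e (i + j))).smulRight (D.a ^ j • y)
  have hf (z : X) : f z = ∑ j ∈ Finset.range l,
      φ (D.a ^ (l - 1 - j) • D.e (i + j) • z) • D.a ^ j • y := by
    simp [f, mul_smul]
  have he (p : ZMod n) (z : X) : f (D.e p • z) = D.e p • f z := by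
    rw [hf, hf, Finset.smul_sum]
    refine Finset.sum_congr rfl fun j _ => ?_
    rw [smul_comm (D.e p)]
    by_cases hp : i + j = p
    · rw [D.e_smul_a_pow_smul_self hy.e_smul hp, hp, D.e_smul_e_smul_self]
    · rw [D.e_smul_a_pow_smul_of_ne hy.e_smul hp, D.e_smul_e_smul_of_ne hp, smul_zero, map_zero,
        zero_smul, smul_zero]
  have ha (z : X) : f (D.a • z) = D.a • f z := by
    obtain ⟨m, rfl⟩ := Nat.exists_eq_add_of_le' hl
    have hshift (j : ℕ) : D.e (i + (j + 1 : ℕ)) • D.a • z = D.a • D.e (i + j) • z := by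
      have := D.a_pow_smul_e_smul 1 (i + j) z
      rw [pow_one] at this
      rw [this]
      push_cast
      rw [add_assoc]
    -- The two sums agree after an index shift. The unmatched term on the left vanishes since `D.a ^
    -- l` kills X, the one on the right since it kills y.
    rw [hf, hf, Finset.smul_sum, Finset.sum_range_succ', Finset.sum_range_succ]
    congr 1
    · refine Finset.sum_congr rfl fun j hj => ?_
      have := Finset.mem_range.1 hj
      rw [hshift, smul_comm D.a (φ _), D.a_smul_a_pow_smul, ← mul_smul, ← pow_succ,
        show m + 1 - 1 - (j + 1) + 1 = m + 1 - 1 - j by omega]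
    · have h0 := D.a_pow_smul_e_smul 1 (i - 1) z
      rw [pow_one] at h0
      rw [smul_comm D.a (φ _), D.a_smul_a_pow_smul, hy.pow_smul, smul_zero]
      have : D.e (i + (0 : ℕ)) • D.a • z = D.a • D.e (i - 1) • z := by
        rw [h0]
        simp
      rw [this]
      have := hX (D.e (i - 1) • z)
      rw [pow_succ, mul_smul] at this
      simp only [Nat.sub_zero, add_tsub_cancel_right]
      rw [this, map_zero, zero_smul]
  refine ⟨{ f with map_smul' := D.map_smul_of_map_a_smul f he ha }, ?_⟩
  change f x = y
  -- For j ≠ 0 either the vertex i + j differs from i, or j is a multiple of n and `φ` vanishes on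
  -- the power l - 1 - j.
  rw [hf, Finset.sum_eq_single 0]
  · have := hφ (l - 1) (by omega)
    simp [hx, this]
  · intro j hj hj0
    have hjl := Finset.mem_range.1 hj
    by_cases hp : i + (j : ZMod n) = i
    · rw [hp, hx, hφ _ (by omega), if_neg (by omega), zero_smul]
    · rw [← hx, D.e_smul_e_smul_of_ne hp, smul_zero, map_zero, zero_smul]
  · intro h0
    exact absurd (Finset.mem_range.2 (by omega)) h0

end Modules

end NakayamaData

/-! ### Finitely generated modules over algebras -/

namespace FGModuleCat

section Exactness

variable {R : Type u} [Ring R]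

theorem mono_of_injective {X Y : FGModuleCat.{u} R} (f : X ⟶ Y)
    (hf : Function.Injective f.hom.hom) : Mono f := by
  have : Mono ((forget₂ (FGModuleCat.{u} R) (ModuleCat.{u} R)).map f) :=
    (ModuleCat.mono_iff_injective _).2 hf
  exact (forget₂ (FGModuleCat.{u} R) (ModuleCat.{u} R)).mono_of_mono_map this

theorem epi_of_surjective {X Y : FGModuleCat.{u} R} (f : X ⟶ Y)
    (hf : Function.Surjective f.hom.hom) : Epi f := by
  have : Epi ((forget₂ (FGModuleCat.{u} R) (ModuleCat.{u} R)).map f) :=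
    (ModuleCat.epi_iff_surjective _).2 hf
  exact (forget₂ (FGModuleCat.{u} R) (ModuleCat.{u} R)).epi_of_epi_map this

theorem sum_hom_apply {ι : Type*} [Fintype ι] {X Y : FGModuleCat.{u} R} (f : ι → (X ⟶ Y)) (x : X) :
    (∑ i, f i).hom.hom x = ∑ i, (f i).hom.hom x := by
  let F : (X ⟶ Y) →+ Y :=
    { toFun := fun f => f.hom.hom x, map_zero' := rfl, map_add' := fun _ _ => rfl }
  exact map_sum F f Finset.univ

variable [IsNoetherianRing R]

theorem surjective_of_epi {X Y : FGModuleCat.{u} R} (f : X ⟶ Y) [Epi f] :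
    Function.Surjective f.hom.hom := by
  have : Epi ((forget₂ (FGModuleCat.{u} R) (ModuleCat.{u} R)).map f) := inferInstance
  exact (ModuleCat.epi_iff_surjective _).1 this

theorem shortExact {X Y Z : FGModuleCat.{u} R} {f : X ⟶ Y} {g : Y ⟶ Z} (w : f ≫ g = 0)
    (hf : Function.Injective f.hom.hom) (hg : Function.Surjective g.hom.hom)
    (hfg : ∀ y, g.hom.hom y = 0 → ∃ x, f.hom.hom x = y) : (ShortComplex.mk f g w).ShortExact := by
  have := mono_of_injective f hf
  have := epi_of_surjective g hg
  refine ShortComplex.ShortExact.mk' ?_ ‹_› ‹_›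
  let lift {W : FGModuleCat.{u} R} (t : W ⟶ Y) (ht : t ≫ g = 0) : W ⟶ X :=
    FGModuleCat.ofHom ((LinearEquiv.ofInjective f.hom.hom hf).symm.toLinearMap ∘ₗ
      t.hom.hom.codRestrict (LinearMap.range f.hom.hom)
        fun z => hfg _ (LinearMap.congr_fun (congrArg (fun h => h.hom.hom) ht) z))
  have hlift {W : FGModuleCat.{u} R} (t : W ⟶ Y) (ht : t ≫ g = 0) : lift t ht ≫ f = t := by
    ext z
    exact congrArg Subtype.val (LinearEquiv.apply_symm_apply (LinearEquiv.ofInjective f.hom.hom hf)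
      (t.hom.hom.codRestrict (LinearMap.range f.hom.hom) _ z))
  exact ShortComplex.exact_of_f_is_kernel _ (KernelFork.IsLimit.ofι f w lift hlift
    fun t ht m hm => by rw [← cancel_mono f, hm, hlift t ht])

end Exactness

section Algebra

variable (k : Type u) {R : Type u} [Field k] [Ring R] [Algebra k R]

/-- The `k`-vector space underlying a module over a `k`-algebra. -/
abbrev moduleOfAlgebra (X : FGModuleCat.{u} R) : Module k X := Module.compHom X (algebraMap k R)

theorem isScalarTower_of_algebra (X : FGModuleCat.{u} R) :
    letI := moduleOfAlgebra k X
    IsScalarTower k R X := by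
  let := moduleOfAlgebra k X
  refine ⟨fun c r x => ?_⟩
  rw [Algebra.smul_def, mul_smul]
  rfl

attribute [local instance] moduleOfAlgebra isScalarTower_of_algebra

theorem finite_of_algebra [Module.Finite k R] (X : FGModuleCat.{u} R) : Module.Finite k X :=
  Module.Finite.trans R X

/-- Hom spaces embed in spaces of k-linear maps between finite-dimensional spaces. -/
theorem exists_sum_smul_eq [Module.Finite k R] (X Y : FGModuleCat.{u} R) :
    ∃ (m : ℕ) (f : Fin m → (X ⟶ Y)), ∀ g : X ⟶ Y, ∃ c : Fin m → k,
      ∀ x, g.hom.hom x = ∑ i, c i • (f i).hom.hom x := by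
  have := finite_of_algebra k X
  have := finite_of_algebra k Y
  have : SMulCommClass R k Y := IsScalarTower.to_smulCommClass'
  have : LinearMap.CompatibleSMul X Y k R := inferInstance
  have : Module.Finite k (X →ₗ[R] Y) :=
    Module.Finite.of_injective (LinearMap.restrictScalarsₗ k R X Y k)
      (LinearMap.restrictScalars_injective k)
  obtain ⟨m, s, hs⟩ := Module.Finite.exists_fin (R := k) (M := X →ₗ[R] Y)
  refine ⟨m, fun i => FGModuleCat.ofHom (s i), fun g => ?_⟩
  obtain ⟨c, hc⟩ := (Submodule.mem_span_range_iff_exists_fun k).1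
    (show g.hom.hom ∈ Submodule.span k (Set.range s) by rw [hs]; trivial)
  refine ⟨c, fun x => ?_⟩
  rw [← hc, LinearMap.sum_apply]
  rfl

/-- Multiplication by a scalar, as an endomorphism. -/
noncomputable def scalar (X : FGModuleCat.{u} R) (c : k) : X ⟶ X :=
  have : SMulCommClass R k X := IsScalarTower.to_smulCommClass'
  have : SMulCommClass k R X := SMulCommClass.symm _ _ _
  FGModuleCat.ofHom (Module.toModuleEnd R (S := k) X c)

include k in
-- Scalars act by endomorphisms of M, so finitely many generators of a Hom space over k also
-- generate it over End M.
theorem isFunctoriallyFinite_additiveClosure [Module.Finite k R] [IsNoetherianRing R]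
    (M : FGModuleCat.{u} R) : IsFunctoriallyFinite (additiveClosure M) := by
  have hlin {X Y : FGModuleCat.{u} R} (f : X ⟶ Y) (c : k) (x : X) :
      f.hom.hom (c • x) = c • f.hom.hom x := f.hom.hom.map_smul (algebraMap k R c) x
  refine _root_.isFunctoriallyFinite_additiveClosure (fun X => ?_) fun X => ?_
  · obtain ⟨m, f, hf⟩ := exists_sum_smul_eq k M X
    refine ⟨m, f, fun g => ?_⟩
    obtain ⟨c, hc⟩ := hf g
    refine ⟨fun i => scalar k M (c i), ?_⟩
    ext x
    refine (sum_hom_apply _ x).trans ((Finset.sum_congr rfl fun i _ => ?_).trans (hc x).symm)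
    exact hlin (f i) (c i) x
  · obtain ⟨m, f, hf⟩ := exists_sum_smul_eq k X M
    refine ⟨m, f, fun g => ?_⟩
    obtain ⟨c, hc⟩ := hf g
    refine ⟨fun i => scalar k M (c i), ?_⟩
    ext x
    exact (sum_hom_apply _ x).trans (hc x).symm

end Algebra

variable {R : Type u} [Ring R]

theorem id_mem_factorIdeal_free (m : ℕ) :
    𝟙 (FGModuleCat.of R (Fin m → R)) ∈
      factorIdeal (· = FGModuleCat.of R R) (FGModuleCat.of R (Fin m → R)) _ := by
  let p (i : Fin m) : FGModuleCat.of R (Fin m → R) ⟶ FGModuleCat.of R R :=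
    FGModuleCat.ofHom (LinearMap.proj i)
  let s (i : Fin m) : FGModuleCat.of R R ⟶ FGModuleCat.of R (Fin m → R) :=
    FGModuleCat.ofHom (LinearMap.single R (fun _ => R) i)
  have : 𝟙 (FGModuleCat.of R (Fin m → R)) = ∑ i : Fin m, p i ≫ s i := by
    refine FGModuleCat.hom_ext (LinearMap.ext fun x => ?_)
    refine Eq.trans ?_ (sum_hom_apply _ x).symm
    exact (LinearMap.sum_single_apply (fun _ => R) x).symm
  rw [this]
  exact sum_mem fun i _ => comp_mem_factorIdeal (𝒢 := (· = FGModuleCat.of R R)) rfl (p i) (s i)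

/-- Every projective module is a direct summand of a free module. -/
theorem id_mem_factorIdeal_of_projective [IsNoetherianRing R] (P : FGModuleCat.{u} R)
    [Projective P] : 𝟙 P ∈ factorIdeal (· = FGModuleCat.of R R) P P := by
  obtain ⟨m, f, hf⟩ := Module.Finite.exists_fin' R P
  let p : FGModuleCat.of R (Fin m → R) ⟶ P := FGModuleCat.ofHom f
  have : Epi p := epi_of_surjective _ hf
  exact id_mem_factorIdeal_of_comp_eq_id (id_mem_factorIdeal_free m)
    (Projective.factorThru (𝟙 P) p) p (Projective.factorThru_comp _ _)

end FGModuleCat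

/-! ### Modules over self-injective Nakayama algebras -/

namespace NakayamaData

open FGModuleCat

attribute [local instance] moduleOfAlgebra isScalarTower_of_algebra

variable {k R : Type u} [Field k] [Ring R] [Algebra k R] {n : ℕ} [NeZero n]
  (D : NakayamaData k R n)

/-- `X` is uniserial, with top at the vertex `p.1` and length `p.2`. -/
def IsUniserial (p : ZMod n × ℕ) : ObjectProperty (FGModuleCat.{u} R) := fun X =>
  ∃ x : X, D.IsGenerator x p.1 p.2

/-- The class of the uniserial modules whose top and length are listed in `S`. -/
def uniserial (S : Set (ZMod n × ℕ)) : ObjectProperty (FGModuleCat.{u} R) := fun X =>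
  ∃ p ∈ S, D.IsUniserial p X

variable {D}

theorem IsGenerator.exists_hom {X Y : FGModuleCat.{u} R} {x : X} {i : ZMod n} {l : ℕ}
    (h : D.IsGenerator x i l) {y : Y} (hy : D.e i • y = y) (hy' : D.a ^ l • y = 0) :
    ∃ f : X ⟶ Y, f.hom.hom x = y := by
  obtain ⟨f, hf⟩ := h.exists_linearMap (k := k) hy hy'
  exact ⟨FGModuleCat.ofHom f, hf⟩

theorem IsGenerator.hom_ext {X Y : FGModuleCat.{u} R} {x : X} {i : ZMod n} {l : ℕ}
    (h : D.IsGenerator x i l) {f g : X ⟶ Y} (hfg : f.hom.hom x = g.hom.hom x) : f = g :=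
  FGModuleCat.hom_ext (h.linearMap_ext hfg)

theorem IsUniserial.nonempty_iso {X Y : FGModuleCat.{u} R} {p : ZMod n × ℕ}
    (hX : D.IsUniserial p X) (hY : D.IsUniserial p Y) : Nonempty (X ≅ Y) := by
  obtain ⟨x, hx⟩ := hX
  obtain ⟨y, hy⟩ := hY
  obtain ⟨f, hf⟩ := hx.exists_hom hy.e_smul hy.pow_smul
  obtain ⟨g, hg⟩ := hy.exists_hom hx.e_smul hx.pow_smul
  exact ⟨⟨f, g, hx.hom_ext ((congrArg g.hom.hom hf).trans hg),
    hy.hom_ext ((congrArg f.hom.hom hg).trans hf)⟩⟩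

theorem IsUniserial.id_mem_factorIdeal {X Y : FGModuleCat.{u} R} {p : ZMod n × ℕ}
    (hX : D.IsUniserial p X) (hY : D.IsUniserial p Y)
    {𝒢 : ObjectProperty (FGModuleCat.{u} R)} (h : 𝟙 X ∈ factorIdeal 𝒢 X X) :
    𝟙 Y ∈ factorIdeal 𝒢 Y Y := by
  obtain ⟨e⟩ := hX.nonempty_iso hY
  exact id_mem_factorIdeal_of_comp_eq_id h e.inv e.hom e.inv_hom_id

theorem IsUniserial.le {X : FGModuleCat.{u} R} {p : ZMod n × ℕ} (hX : D.IsUniserial p X) :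
    p.2 ≤ n + 1 := by
  obtain ⟨x, hx⟩ := hX
  exact hx.le

variable (D)

theorem exists_isUniserial {p : ZMod n × ℕ} (hp : p.2 ≤ n + 1) :
    ∃ X : FGModuleCat.{u} R, D.IsUniserial p X := by
  obtain ⟨i, l⟩ := p
  obtain ⟨t, ht⟩ := Nat.exists_eq_add_of_le' hp
  dsimp only at ht
  -- With t = n + 1 - l, this element lies t steps below the top of the projective at i - t, hence
  -- at the vertex i with l steps left.
  let x : R := D.a ^ t * D.e (i - t)
  let X := Submodule.span R {x}
  have he : D.e i * x = x := by
    simp only [x]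
    rw [D.a_pow_mul_e, sub_add_cancel, ← mul_assoc, D.e_mul_e_self]
  have hne : D.a ^ n * D.e (i - t) ≠ 0 := D.a_pow_mul_e_ne _
  refine ⟨FGModuleCat.of R X, ⟨x, Submodule.mem_span_singleton_self x⟩, ?_, ?_, ?_, ?_⟩
  · exact Subtype.ext he
  · refine Subtype.ext ?_
    change D.a ^ l * (D.a ^ t * D.e (i - t)) = 0
    rw [← mul_assoc, ← pow_add, D.a_pow_eq_zero (by omega), zero_mul]
  · intro j hj h0
    refine hne ?_
    have h0' : D.a ^ j * (D.a ^ t * D.e (i - t)) = 0 := congrArg Subtype.val h0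
    have hpow : D.a ^ n = D.a ^ (n - (j + t)) * (D.a ^ j * D.a ^ t) := by
      dsimp only at hj
      rw [← pow_add, ← pow_add, Nat.sub_add_cancel (by omega)]
    rw [hpow, mul_assoc, mul_assoc, h0', mul_zero]
  · rw [eq_top_iff]
    rintro ⟨z, hz⟩ -
    obtain ⟨r, rfl⟩ := Submodule.mem_span_singleton.1 hz
    exact Submodule.mem_span_singleton.2 ⟨r, rfl⟩

/-- At length n + 1 the relation `D.a ^ (n + 1) • x = 0` is no constraint, so the generator can be
sent to any preimage projected to the vertex i. -/
theorem projective_of_isUniserial [IsNoetherianRing R] {P : FGModuleCat.{u} R} {i : ZMod n}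
    (hP : D.IsUniserial (i, n + 1) P) : Projective P := by
  obtain ⟨x, hx⟩ := hP
  refine ⟨fun {E Y} f g hg => ?_⟩
  obtain ⟨z, hz⟩ := surjective_of_epi g (f.hom.hom x)
  obtain ⟨h, hh⟩ := hx.exists_hom (y := D.e i • z) (D.e_smul_e_smul_self _ _)
    (by rw [D.a_pow, zero_smul])
  refine ⟨h, hx.hom_ext ?_⟩
  change g.hom.hom (h.hom.hom x) = _
  rw [hh, map_smul, hz, ← map_smul, hx.e_smul]

/-- The top and the length of the syzygy of a uniserial module. -/
def syzygyType (p : ZMod n × ℕ) : ZMod n × ℕ := (p.1 + p.2, n + 1 - p.2)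

/-- The combinatorial condition for the vanishing of `Ext¹` between uniserial modules. -/
def ExtVanishes (p q : ZMod n × ℕ) : Prop :=
  ∀ t < q.2, q.1 + t = p.1 + p.2 → q.2 ≤ t + (n + 1 - p.2) → p.2 ≤ t

variable {D} in
-- The condition can be tested on the basis `D.a ^ t • y`, t < m. Such a vector sits at the vertex i
-- + t, is killed by `D.a ^ (n + 1 - l)` iff m ≤ t + (n + 1 - l), and is a multiple of `D.a ^ l` iff
-- l ≤ t.
theorem IsGenerator.forall_exists_iff {Y : FGModuleCat.{u} R} {y : Y} {i : ZMod n} {m : ℕ}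
    (hy : D.IsGenerator y i m) (p : ZMod n) (l : ℕ) :
    (∀ z : Y, D.e (p + l) • z = z → D.a ^ (n + 1 - l) • z = 0 →
      ∃ v : Y, D.e p • v = v ∧ D.a ^ l • v = z) ↔ ExtVanishes (p, l) (i, m) := by
  have hs : SMulCommClass R k Y := IsScalarTower.to_smulCommClass'
  have hm := hy.le
  constructor
  · intro h t ht hti htm
    dsimp only at ht hti htm ⊢
    obtain ⟨v, -, hv⟩ := h (D.a ^ t • y) (D.e_smul_a_pow_smul_self hy.e_smul hti)
      (by rw [D.a_pow_smul_a_pow_smul, D.a_pow_smul_eq_zero_of_le hy.pow_smul (by omega)])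
    by_contra! hlt
    obtain ⟨c, rfl⟩ := hy.exists_eq_sum (k := k) v
    -- The relation between `D.a ^ l • v` and `D.a ^ t • y`, t < l, as a vanishing combination: -1
    -- at t, and the coefficients of v shifted by l.
    have hsum : ∑ j ∈ Finset.range (l + (n + 1)), (if l ≤ j then c (j - l) else
        if j = t then -1 else 0) • D.a ^ j • y = 0 := by
      rw [Finset.sum_range_add, Finset.sum_eq_single_of_mem t (by simpa using hlt), if_neg (by omega),
        if_pos rfl]
      · rw [← hv, Finset.smul_sum]
        simp [smul_comm (D.a ^ l), D.a_pow_smul_a_pow_smul]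
      · intro j hj hjt
        rw [if_neg (by simpa using hj), if_neg hjt, zero_smul]
    have := D.coeff_eq_zero hy.pow_smul hy.pow_smul_ne hsum t (by omega) ht
    simp [not_le.2 hlt] at this
  · intro h z hz hz'
    obtain ⟨c, hc⟩ := hy.exists_eq_sum (k := k) z
    have hz'' := hz'
    rw [hc, Finset.smul_sum] at hz''
    simp only [smul_comm (D.a ^ (n + 1 - l)), D.a_pow_smul_a_pow_smul] at hz''
    have hc0 (t : ℕ) (ht : t + (n + 1 - l) < m) : c t = 0 := by
      have := D.coeff_eq_zero (c := fun j => if n + 1 - l ≤ j then c (j - (n + 1 - l)) else 0)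
        (N := n + 1 + (n + 1 - l)) hy.pow_smul hy.pow_smul_ne (by
          rw [add_comm, Finset.sum_range_add, Finset.sum_eq_zero, zero_add]
          · simpa using hz''
          · intro j hj
            rw [if_neg (not_le.2 (Finset.mem_range.1 hj)), zero_smul]) (t + (n + 1 - l)) (by omega) ht
      rwa [if_pos (by omega), Nat.add_sub_cancel] at this
    -- Division of z by `D.a ^ l` term by term. Terms at other vertices do not contribute to z, and
    -- nonzero ones with j < l are excluded by `h` and `hc0`.
    refine ⟨∑ j ∈ Finset.range (n + 1), (if l ≤ j ∧ i + j = p + l then c j else 0) •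
      D.a ^ (j - l) • y, ?_, ?_⟩
    · rw [Finset.smul_sum]
      refine Finset.sum_congr rfl fun j _ => ?_
      split_ifs with hj
      · rw [smul_comm, D.e_smul_a_pow_smul_self hy.e_smul]
        rw [Nat.cast_sub hj.1, ← add_sub_assoc, hj.2, add_sub_cancel_right]
      · rw [zero_smul, smul_zero]
    · rw [← hz, hc, Finset.smul_sum, Finset.smul_sum]
      refine Finset.sum_congr rfl fun j hj => ?_
      rw [smul_comm, smul_comm (D.e _), D.a_pow_smul_a_pow_smul]
      by_cases hji : i + (j : ZMod n) = p + l
      · rw [D.e_smul_a_pow_smul_self hy.e_smul hji]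
        by_cases hlj : l ≤ j
        · rw [if_pos ⟨hlj, hji⟩, Nat.add_sub_cancel' hlj]
        · rw [if_neg (by tauto), zero_smul]
          by_cases hjm : j < m
          · rw [hc0 j (by
              by_contra hcon
              exact hlj (h j hjm hji (not_lt.1 hcon))), zero_smul]
          · rw [D.a_pow_smul_eq_zero_of_le hy.pow_smul (not_lt.1 hjm), smul_zero]
      · rw [D.e_smul_a_pow_smul_of_ne hy.e_smul hji, if_neg (by tauto), zero_smul, smul_zero]

section Noetherian

variable [IsNoetherianRing R]

/-- The projective cover of a uniserial module and its kernel. -/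
theorem exists_shortExact {X : FGModuleCat.{u} R} {x : X} {i : ZMod n} {l : ℕ}
    (hx : D.IsGenerator x i l) :
    ∃ S : ShortComplex (FGModuleCat.{u} R), S.ShortExact ∧ S.X₃ = X ∧
      ∃ (x₁ : S.X₁) (x₂ : S.X₂), D.IsGenerator x₁ (i + l) (n + 1 - l) ∧
        D.IsGenerator x₂ i (n + 1) ∧ S.f.hom.hom x₁ = D.a ^ l • x₂ := by
  have hl := hx.le
  obtain ⟨P, y, hy⟩ := D.exists_isUniserial (p := (i, n + 1)) le_rfl
  obtain ⟨K, z, hz⟩ := D.exists_isUniserial (p := (i + l, n + 1 - l)) (Nat.sub_le _ _)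
  dsimp only at hy hz
  obtain ⟨f, hf⟩ := hz.exists_hom (y := D.a ^ l • y) (D.e_smul_a_pow_smul_self hy.e_smul rfl)
    (by rw [D.a_pow_smul_a_pow_smul, Nat.sub_add_cancel hl, hy.pow_smul])
  obtain ⟨g, hg⟩ := hy.exists_hom hx.e_smul (by rw [D.a_pow, zero_smul])
  have hgl (c : k) (y : P) : g.hom.hom (c • y) = c • g.hom.hom y :=
    g.hom.hom.map_smul (algebraMap k R c) y
  have hfl (c : k) (z : K) : f.hom.hom (c • z) = c • f.hom.hom z :=
    f.hom.hom.map_smul (algebraMap k R c) z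
  have w : f ≫ g = 0 := by
    refine hz.hom_ext ?_
    change g.hom.hom (f.hom.hom z) = 0
    rw [hf, map_smul, hg, hx.pow_smul]
  have hfj (j : ℕ) : f.hom.hom (D.a ^ j • z) = D.a ^ (j + l) • y := by
    rw [map_smul, hf, D.a_pow_smul_a_pow_smul]
  refine ⟨ShortComplex.mk f g w, FGModuleCat.shortExact w ?_ ?_ ?_, rfl, z, y, hz, hy, hf⟩
  · rw [injective_iff_map_eq_zero]
    intro u hu
    obtain ⟨c, rfl⟩ := hz.exists_eq_sum (k := k) u
    simp only [map_sum, hfl, hfj] at hu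
    refine Finset.sum_eq_zero fun j hj => ?_
    by_cases hjl : j + l < n + 1
    · have := D.coeff_eq_zero (c := fun j => if l ≤ j then c (j - l) else 0) (N := n + 1 + l)
        hy.pow_smul hy.pow_smul_ne (by
          rw [add_comm, Finset.sum_range_add, Finset.sum_eq_zero, zero_add]
          · simpa [add_comm] using hu
          · intro j hj
            rw [if_neg (by simpa using hj), zero_smul]) (j + l) (by omega) hjl
      rw [if_pos (by omega), Nat.add_sub_cancel] at this
      rw [this, zero_smul]
    · rw [D.a_pow_smul_eq_zero_of_le hz.pow_smul (by omega), smul_zero]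
  · intro u
    obtain ⟨r, rfl⟩ := hx.exists_eq_smul u
    exact ⟨r • y, by rw [map_smul, hg]⟩
  · intro u hu
    obtain ⟨c, rfl⟩ := hy.exists_eq_sum (k := k) u
    simp only [map_sum, hgl, map_smul, hg] at hu
    have hc := D.coeff_eq_zero hx.pow_smul hx.pow_smul_ne hu
    -- A kernel element has no terms in powers below l, and `D.a ^ (l + j) • y` is the image of `D.a
    -- ^ j • z`.
    refine ⟨∑ j ∈ Finset.range (n + 1 - l), c (l + j) • D.a ^ j • z, ?_⟩
    conv_rhs => rw [show n + 1 = l + (n + 1 - l) by omega, Finset.sum_range_add]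
    rw [Finset.sum_eq_zero (s := Finset.range l), zero_add, map_sum]
    · exact Finset.sum_congr rfl fun j _ => by rw [hfl, hfj, add_comm]
    · intro j hj
      have := Finset.mem_range.1 hj
      rw [hc j (by omega) this, zero_smul]

theorem exists_shortExact_syzygy {X : FGModuleCat.{u} R} {p : ZMod n × ℕ}
    (hX : D.IsUniserial p X) :
    ∃ S : ShortComplex (FGModuleCat.{u} R), S.ShortExact ∧ Projective S.X₂ ∧ S.X₃ = X ∧
      D.IsUniserial (syzygyType p) S.X₁ := by
  obtain ⟨x, hx⟩ := hX
  obtain ⟨S, hS, hS₃, x₁, x₂, hx₁, hx₂, -⟩ := D.exists_shortExact hx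
  exact ⟨S, hS, D.projective_of_isUniserial ⟨x₂, hx₂⟩, hS₃, x₁, hx₁⟩

/-- Maps from the syzygy to Y are the elements at the vertex i + l killed by `D.a ^ (n + 1 - l)`.
Such a map extends to the projective cover iff its element is `D.a ^ l` times an element at the
vertex i. -/
theorem subsingleton_ext_one_iff [HasExt.{w} (FGModuleCat.{u} R)] {X Y : FGModuleCat.{u} R}
    {p q : ZMod n × ℕ} (hX : D.IsUniserial p X) (hY : D.IsUniserial q Y) :
    Subsingleton (Ext.{w} X Y 1) ↔ ExtVanishes p q := by
  obtain ⟨x, hx⟩ := hX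
  obtain ⟨y, hy⟩ := hY
  obtain ⟨S, hS, rfl, x₁, x₂, hx₁, hx₂, hf⟩ := D.exists_shortExact hx
  have : Projective S.X₂ := D.projective_of_isUniserial ⟨x₂, hx₂⟩
  rw [_root_.subsingleton_ext_one_iff hS, ← hy.forall_exists_iff]
  constructor
  · intro h z hz hz'
    obtain ⟨g, hg⟩ := hx₁.exists_hom hz hz'
    obtain ⟨g', rfl⟩ := h g
    refine ⟨g'.hom.hom x₂, by rw [← map_smul, hx₂.e_smul], ?_⟩
    rw [← map_smul, ← hf]
    exact hg
  · intro h g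
    obtain ⟨v, hv, hv'⟩ := h (g.hom.hom x₁) (by rw [← map_smul, hx₁.e_smul])
      (by rw [← map_smul, hx₁.pow_smul, map_zero])
    obtain ⟨g', hg'⟩ := hx₂.exists_hom hv (by rw [D.a_pow, zero_smul])
    refine ⟨g', hx₁.hom_ext ?_⟩
    change g'.hom.hom (S.f.hom.hom x₁) = _
    rw [hf, map_smul, hg', hv']

theorem subsingleton_ext_iff [HasExt.{w} (FGModuleCat.{u} R)] {X Y : FGModuleCat.{u} R}
    {p q : ZMod n × ℕ} (hX : D.IsUniserial p X) (hY : D.IsUniserial q Y) (s : ℕ) :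
    Subsingleton (Ext.{w} X Y (s + 1)) ↔ ExtVanishes (syzygyType^[s] p) q := by
  induction s generalizing X p with
  | zero => exact D.subsingleton_ext_one_iff hX hY
  | succ s ih =>
    obtain ⟨S, hS, hP, rfl, hK⟩ := D.exists_shortExact_syzygy hX
    rw [Function.iterate_succ_apply, ← ih hK]
    exact subsingleton_ext_succ_iff hS Y s

end Noetherian

end NakayamaData

/-! ### Decomposition into uniserial modules and the combinatorial criterion. -/

namespace NakayamaData

open FGModuleCat

attribute [local instance] moduleOfAlgebra isScalarTower_of_algebra

variable {k R : Type u} [Field k] [Ring R] [Algebra k R] {n : ℕ} [NeZero n] (D : NakayamaData k R n)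

/-- The identity is the sum over i of the projections onto the projectives generated by `D.e i`. -/
theorem id_mem_factorIdeal_regular {S : Set (ZMod n × ℕ)} (hS : ∀ i, (i, n + 1) ∈ S) :
    𝟙 (FGModuleCat.of R R) ∈ factorIdeal (D.uniserial S) (FGModuleCat.of R R) _ := by
  choose X hX using fun i => D.exists_isUniserial (p := (i, n + 1)) le_rfl
  choose x hx using hX
  choose s hs using fun i => (hx i).exists_hom (Y := FGModuleCat.of R R) (y := D.e i)
    (D.e_mul_e_self i) (by rw [D.a_pow, zero_smul])
  let r (i : ZMod n) : FGModuleCat.of R R ⟶ X i :=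
    FGModuleCat.ofHom (LinearMap.toSpanSingleton R (X i) (x i))
  have : 𝟙 (FGModuleCat.of R R) = ∑ i, r i ≫ s i := by
    refine FGModuleCat.hom_ext (LinearMap.ext_ring ?_)
    refine Eq.trans ?_ (sum_hom_apply _ _).symm
    refine D.sum_e.symm.trans (Finset.sum_congr rfl fun i _ => ?_)
    change _ = (s i).hom.hom ((1 : R) • x i)
    rw [one_smul, hs]
  rw [this]
  exact sum_mem fun i _ => comp_mem_factorIdeal ⟨_, hS i, x i, hx i⟩ (r i) (s i)

/-- Take l minimal with `D.a ^ l` killing X. Some x at a single vertex survives `D.a ^ (l - 1)`, and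
it generates a uniserial submodule of maximal length, which splits off. -/
theorem exists_split_uniserial (X : FGModuleCat.{u} R) [Nontrivial X] :
    ∃ (p : ZMod n × ℕ) (U : FGModuleCat.{u} R) (r : X ⟶ U) (s : U ⟶ X),
      1 ≤ p.2 ∧ D.IsUniserial p U ∧ s ≫ r = 𝟙 U := by
  classical
  have hex : ∃ l, ∀ z : X, D.a ^ l • z = 0 := ⟨n + 1, fun z => by rw [D.a_pow, zero_smul]⟩
  obtain ⟨l, hl, hmin⟩ : ∃ l, (∀ z : X, D.a ^ l • z = 0) ∧
      ∀ m < l, ¬ ∀ z : X, D.a ^ m • z = 0 :=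
    ⟨Nat.find hex, Nat.find_spec hex, fun m hm => Nat.find_min hex hm⟩
  have hl1 : 1 ≤ l := by
    by_contra! h0
    obtain ⟨z, hz⟩ := exists_ne (0 : X)
    obtain rfl : l = 0 := by omega
    exact hz (by simpa using hl z)
  have hln : l ≤ n + 1 := by
    by_contra! h
    exact hmin (n + 1) h fun z => by rw [D.a_pow, zero_smul]
  obtain ⟨i, x, hx, hx'⟩ : ∃ (i : ZMod n) (x : X), D.e i • x = x ∧ D.a ^ (l - 1) • x ≠ 0 := by
    by_contra! hcon
    refine hmin (l - 1) (by omega) fun z => ?_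
    rw [← D.sum_e_smul z, Finset.smul_sum]
    exact Finset.sum_eq_zero fun i _ => hcon i _ (D.e_smul_e_smul_self _ _)
  obtain ⟨U, y, hy⟩ := D.exists_isUniserial (p := (i, l)) hln
  obtain ⟨s, hs⟩ := hy.exists_hom hx (hl x)
  obtain ⟨r, hr⟩ := exists_retraction (k := k) hl1 hx hx' hl hy
  exact ⟨(i, l), U, FGModuleCat.ofHom r, s, hl1, ⟨y, hy⟩,
    hy.hom_ext ((congrArg r hs).trans hr)⟩

variable [Module.Finite k R] [IsNoetherianRing R]

/-- Every finitely generated module is a direct sum of uniserial modules. -/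
theorem isDirectSumOf_uniserial (X : FGModuleCat.{u} R) :
    IsDirectSumOf (D.uniserial {p | 1 ≤ p.2}) X := by
  induction hd : Module.finrank k X using Nat.strong_induction_on generalizing X with
  | _ d ih =>
    rcases subsingleton_or_nontrivial X with hX | hX
    · have : 𝟙 X = 0 := FGModuleCat.hom_ext (LinearMap.ext fun x => Subsingleton.elim _ _)
      rw [IsDirectSumOf, this]
      exact zero_mem _
    obtain ⟨p, U, r, s, hp, hU, hsr⟩ := D.exists_split_uniserial X
    let X' : FGModuleCat.{u} R := FGModuleCat.of R (LinearMap.ker r.hom.hom)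
    let ι : X' ⟶ X := FGModuleCat.ofHom (LinearMap.ker r.hom.hom).subtype
    have hsr' (z : U) : r.hom.hom (s.hom.hom z) = z :=
      LinearMap.congr_fun (congrArg (fun h => h.hom.hom) hsr) z
    let π : X ⟶ X' := FGModuleCat.ofHom
      (LinearMap.codRestrict (LinearMap.ker r.hom.hom) (LinearMap.id - s.hom.hom ∘ₗ r.hom.hom)
        fun z => by
          rw [LinearMap.mem_ker, LinearMap.sub_apply, map_sub, LinearMap.comp_apply, hsr',
            LinearMap.id_apply, sub_self])
    have hπι : r ≫ s + π ≫ ι = 𝟙 X := by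
      refine FGModuleCat.hom_ext (LinearMap.ext fun z => ?_)
      exact add_sub_cancel (s.hom.hom (r.hom.hom z)) z
    have hιπ : ι ≫ π = 𝟙 X' := by
      refine FGModuleCat.hom_ext (LinearMap.ext fun z => Subtype.ext ?_)
      have hz : r.hom.hom z.1 = 0 := z.2
      change z.1 - s.hom.hom (r.hom.hom z.1) = z.1
      rw [hz, map_zero, sub_zero]
    have hlt : Module.finrank k X' < d := by
      have := finite_of_algebra k X
      let j : X' →ₗ[k] X :=
        { toFun := Subtype.val, map_add' := fun _ _ => rfl, map_smul' := fun _ _ => rfl }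
      rw [← hd, ← LinearMap.finrank_range_of_inj (f := j) Subtype.val_injective]
      refine Submodule.finrank_lt ?_
      intro htop
      obtain ⟨u, hu⟩ := hU
      obtain ⟨z, hz⟩ := (LinearMap.range_eq_top.1 htop) (s.hom.hom u)
      have h0 : r.hom.hom (s.hom.hom u) = 0 := by
        rw [← hz]
        exact z.2
      rw [hsr'] at h0
      exact hu.pow_smul_ne 0 hp (by rw [h0, smul_zero])
    -- Splittings of the complement extend to X along `π` and `ι` because `ι ≫ π = 𝟙 X'`.
    have key : ∀ f : X' ⟶ X', f ∈ AddSubgroup.closure {h : X' ⟶ X' |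
        ∃ G, D.uniserial {p | 1 ≤ p.2} G ∧ ∃ (r : X' ⟶ G) (s : G ⟶ X'),
          s ≫ r = 𝟙 G ∧ r ≫ s = h} → π ≫ f ≫ ι ∈ AddSubgroup.closure {h : X ⟶ X |
        ∃ G, D.uniserial {p | 1 ≤ p.2} G ∧ ∃ (r : X ⟶ G) (s : G ⟶ X),
          s ≫ r = 𝟙 G ∧ r ≫ s = h} := by
      intro f hf
      induction hf using AddSubgroup.closure_induction with
      | mem f hf =>
        obtain ⟨G, hG, r', s', hsr', rfl⟩ := hf
        refine AddSubgroup.subset_closure ⟨G, hG, π ≫ r', s' ≫ ι, ?_, by simp⟩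
        rw [Category.assoc, reassoc_of% hιπ, hsr']
      | zero => simp
      | add f g _ _ hf hg =>
        rw [Preadditive.add_comp, Preadditive.comp_add]
        exact add_mem hf hg
      | neg f _ hf =>
        rw [Preadditive.neg_comp, Preadditive.comp_neg]
        exact neg_mem hf
    rw [IsDirectSumOf, ← hπι]
    refine add_mem (AddSubgroup.subset_closure ⟨U, ⟨p, hp, hU⟩, r, s, hsr, rfl⟩) ?_
    have := key _ (ih _ hlt X' rfl)
    rwa [Category.id_comp] at this

/-- Over a self-injective Nakayama algebra, cluster-tilting is a combinatorial condition on the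
tops and lengths of uniserial modules. -/
theorem isClusterTilting [HasExt.{w} (FGModuleCat.{u} R)] {d : ℕ} {M : FGModuleCat.{u} R}
    {S : Set (ZMod n × ℕ)} (hM : 𝟙 M ∈ factorIdeal (D.uniserial S) M M)
    (hS : ∀ p ∈ S, ∃ X, D.IsUniserial p X ∧ 𝟙 X ∈ factorIdeal (· = M) X X)
    (hext : ∀ p ∈ S, ∀ q ∈ S, ∀ s, s + 2 ≤ d → ExtVanishes (syzygyType^[s] p) q)
    (hleft : ∀ p : ZMod n × ℕ, 1 ≤ p.2 → p.2 ≤ n + 1 →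
      (∀ q ∈ S, ∀ s, s + 2 ≤ d → ExtVanishes (syzygyType^[s] p) q) → p ∈ S)
    (hright : ∀ p : ZMod n × ℕ, 1 ≤ p.2 → p.2 ≤ n + 1 →
      (∀ q ∈ S, ∀ s, s + 2 ≤ d → ExtVanishes (syzygyType^[s] q) p) → p ∈ S) :
    IsClusterTilting.{w} d (additiveClosure M) := by
  refine isClusterTilting_additiveClosure
    (FGModuleCat.isFunctoriallyFinite_additiveClosure k M) D.isDirectSumOf_uniserial hM
    ?_ ?_ ?_ ?_
  · rintro G ⟨p, hp, hG⟩
    obtain ⟨X, hX, hXM⟩ := hS p hp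
    exact hX.id_mem_factorIdeal hG hXM
  · rintro G H ⟨p, hp, hG⟩ ⟨q, hq, hH⟩ i h1 hi
    obtain ⟨s, rfl⟩ := Nat.exists_eq_add_of_le' h1
    exact (D.subsingleton_ext_iff hG hH s).2 (hext p hp q hq s (by omega))
  · rintro X ⟨p, hp, hX⟩ h
    refine ⟨p, hleft p hp hX.le fun q hq s hs => ?_, hX⟩
    obtain ⟨G, hG, -⟩ := hS q hq
    exact (D.subsingleton_ext_iff hX hG s).1 (h G ⟨q, hq, hG⟩ (s + 1) (by omega) (by omega))
  · rintro X ⟨p, hp, hX⟩ h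
    refine ⟨p, hright p hp hX.le fun q hq s hs => ?_, hX⟩
    obtain ⟨G, hG, -⟩ := hS q hq
    exact (D.subsingleton_ext_iff hG hX s).1 (h G ⟨q, hq, hG⟩ (s + 1) (by omega) (by omega))

end NakayamaData

/-! ### Combinatorics of tops and lengths. -/

namespace NakayamaData

section Combinatorics

variable {n : ℕ}

theorem syzygyType_iterate_le {p : ZMod n × ℕ} (hp : p.2 ≤ n + 1) (s : ℕ) :
    (syzygyType^[s] p).2 ≤ n + 1 := by
  cases s with
  | zero => exact hp
  | succ s => rw [Function.iterate_succ_apply']; exact Nat.sub_le _ _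

/-- Numerical form of self-injectivity: modules of length n + 1 are injective. -/
theorem extVanishes_of_right {p q : ZMod n × ℕ} (hp : p.2 ≤ n + 1) (hq : q.2 = n + 1) :
    ExtVanishes p q := fun t _ _ _ => by omega

/-- `syzygyType` alternates between the lengths n + 1 and 0, and both satisfy the condition
trivially. -/
theorem extVanishes_iterate_of_left {p : ZMod n × ℕ} (hp : p.2 = n + 1) (q : ZMod n × ℕ) (s : ℕ) :
    ExtVanishes (syzygyType^[s] p) q := by
  have : (syzygyType^[s] p).2 = n + 1 ∨ (syzygyType^[s] p).2 = 0 := by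
    induction s with
    | zero => exact Or.inl hp
    | succ s ih =>
      rw [Function.iterate_succ_apply']
      rcases ih with h | h <;> simp [syzygyType, h]
  intro t ht _ _
  omega

/-- Two syzygies move the top by l + (n + 1 - l) = n + 1, which is 1 modulo n, and restore the
length. -/
theorem syzygyType_iterate_two_mul {i : ZMod n} {l : ℕ} (hl : l ≤ n + 1) (m : ℕ) :
    syzygyType^[2 * m] (i, l) = (i + m, l) := by
  induction m with
  | zero => simp
  | succ m ih =>
    rw [show 2 * (m + 1) = 2 * m + 1 + 1 by ring, Function.iterate_succ_apply',
      Function.iterate_succ_apply', ih]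
    ext
    · simp only [syzygyType]
      push_cast [Nat.cast_sub hl]
      simp
      ring
    · simp only [syzygyType]
      omega

theorem syzygyType_iterate_two_mul_add_one {i : ZMod n} {l : ℕ} (hl : l ≤ n + 1) (m : ℕ) :
    syzygyType^[2 * m + 1] (i, l) = (i + m + l, n + 1 - l) := by
  rw [Function.iterate_succ_apply', syzygyType_iterate_two_mul hl]
  rfl

/-- The residue of -x avoids 0, …, n - 2, so it is n - 1. -/
theorem eq_one_of_forall_add_ne_zero [NeZero n] {x : ZMod n}
    (h : ∀ m : ℕ, m + 2 ≤ n → x + m ≠ 0) : x = 1 := by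
  have hlt := ZMod.val_lt (-x)
  have hval : (((-x).val : ℕ) : ZMod n) = -x := ZMod.natCast_zmod_val _
  have hn : (-x).val + 1 = n := by
    by_contra hne
    exact h (-x).val (by omega) (by rw [hval, add_neg_cancel])
  have : (((-x).val + 1 : ℕ) : ZMod n) = 0 := by rw [hn, ZMod.natCast_self]
  push_cast at this
  rw [hval] at this
  linear_combination -this

theorem natCast_add_one_ne_zero {m : ℕ} (hm : m + 2 ≤ n) : (m : ZMod n) + 1 ≠ 0 := by
  intro h
  have : ((m + 1 : ℕ) : ZMod n) = 0 := by push_cast; exact h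
  have := Nat.le_of_dvd (by omega) ((ZMod.natCast_eq_zero_iff _ _).1 this)
  omega

theorem eq_one_of_natCast_eq_one {l : ℕ} (h1 : 1 ≤ l) (hl : l ≤ n) (h : (l : ZMod n) = 1) :
    l = 1 := by
  have : ((l - 1 : ℕ) : ZMod n) = 0 := by rw [Nat.cast_sub h1, h]; simp
  have := (ZMod.natCast_eq_zero_iff _ _).1 this
  rcases Nat.eq_zero_or_pos (l - 1) with h0 | h0
  · omega
  · have := Nat.le_of_dvd h0 this
    omega

/-- For s = 2m or s = 2m + 1 an obstruction would require m + 1 = 0 modulo n, but the bound on s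
gives m ≤ n - 2. -/
theorem simple_extVanishes {s : ℕ} (hs : s + 3 ≤ 2 * n) :
    ExtVanishes (syzygyType^[s] ((-1 : ZMod n), 1)) (-1, 1) := by
  obtain ⟨m, rfl | rfl⟩ := Nat.even_or_odd' s
  · rw [syzygyType_iterate_two_mul (by omega)]
    intro t ht h _
    obtain rfl : t = 0 := by simpa using ht
    refine absurd ?_ (natCast_add_one_ne_zero (n := n) (m := m) (by omega))
    simp at h
    linear_combination -h
  · rw [syzygyType_iterate_two_mul_add_one (by omega)]
    intro t ht h _
    obtain rfl : t = 0 := by simpa using ht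
    refine absurd ?_ (natCast_add_one_ne_zero (n := n) (m := m) (by omega))
    simp at h
    linear_combination -h

/-- Against a simple module only t = 0 occurs. Odd syzygies exclude all tops i but -1, and even ones
exclude all values of i + l but 0. -/
theorem eq_simple_of_left [NeZero n] {p : ZMod n × ℕ} (h1 : 1 ≤ p.2) (hl : p.2 ≤ n)
    (h : ∀ s, s + 3 ≤ 2 * n → ExtVanishes (syzygyType^[s] p) (-1, 1)) : p = (-1, 1) := by
  obtain ⟨i, l⟩ := p
  dsimp only at h1 hl
  have hi : i + 2 = 1 := eq_one_of_forall_add_ne_zero fun m hm h0 => by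
    have := h (2 * m + 1) (by omega)
    rw [syzygyType_iterate_two_mul_add_one (by omega)] at this
    have := this 0 one_pos (by
      dsimp only
      rw [Nat.cast_sub (by omega)]
      simp
      linear_combination -h0) (by dsimp only; omega)
    dsimp only at this
    omega
  have hil : i + l + 1 = 1 := eq_one_of_forall_add_ne_zero fun m hm h0 => by
    have := h (2 * m) (by omega)
    rw [syzygyType_iterate_two_mul (by omega)] at this
    have := this 0 one_pos (by
      simp
      linear_combination -h0) (by dsimp only; omega)
    dsimp only at this
    omega
  rw [Prod.mk.injEq]
  exact ⟨by linear_combination hi,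
    eq_one_of_natCast_eq_one h1 hl (by linear_combination hil - hi)⟩

/-- Even syzygies of the simple module, tested at t = 0, force the top to be at -1. Odd ones, tested
at the socle t = l - 1, force the socle to be there too. -/
theorem eq_simple_of_right [NeZero n] {p : ZMod n × ℕ} (h1 : 1 ≤ p.2) (hl : p.2 ≤ n)
    (h : ∀ s, s + 3 ≤ 2 * n → ExtVanishes (syzygyType^[s] (-1, 1)) p) : p = (-1, 1) := by
  obtain ⟨i, l⟩ := p
  dsimp only at h1 hl
  have hi : -i = 1 := eq_one_of_forall_add_ne_zero fun m hm h0 => by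
    have := h (2 * m) (by omega)
    rw [syzygyType_iterate_two_mul (by omega)] at this
    have := this 0 h1 (by
      simp
      linear_combination -h0) (by dsimp only; omega)
    dsimp only at this
    omega
  have hil : -(i + l - 1) = 1 := eq_one_of_forall_add_ne_zero fun m hm h0 => by
    have := h (2 * m + 1) (by omega)
    rw [syzygyType_iterate_two_mul_add_one (by omega)] at this
    have := this (l - 1) (by dsimp only; omega) (by
      dsimp only
      rw [Nat.cast_sub h1]
      simp
      linear_combination -h0) (by dsimp only; omega)
    dsimp only at this
    omega
  rw [Prod.mk.injEq]
  exact ⟨by linear_combination -hi,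
    eq_one_of_natCast_eq_one h1 hl (by linear_combination hi - hil)⟩

instance (p q : ZMod n × ℕ) : Decidable (ExtVanishes p q) := by
  unfold ExtVanishes
  infer_instance

/-- The types of the nonprojective summands in the cluster-tilting module for `n = 3`. -/
def typesThree : Finset (ZMod 3 × ℕ) := {(0, 3), (1, 2), (1, 1)}

/-- The types of the nonprojective summands in the cluster-tilting module for `n = 6`. -/
def typesSix : Finset (ZMod 6 × ℕ) :=
  {(4, 2), (5, 1), (1, 5), (1, 6), (1, 2), (2, 1), (4, 5), (4, 6)}

theorem typesThree_extVanishes : ∀ p ∈ typesThree, ∀ q ∈ typesThree, ExtVanishes p q := by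
  decide +kernel

theorem typesSix_extVanishes : ∀ p ∈ typesSix, ∀ q ∈ typesSix, ExtVanishes p q := by
  decide +kernel

/-- Maximality, checked on all nonprojective types: vanishing on either side alone already forces
membership. -/
theorem mem_typesThree : ∀ i : ZMod 3, ∀ l < 4, 1 ≤ l →
    ((∀ q ∈ typesThree, ExtVanishes (i, l) q) ∨ (∀ q ∈ typesThree, ExtVanishes q (i, l))) →
    (i, l) ∈ typesThree := by
  decide +kernel

theorem mem_typesSix : ∀ i : ZMod 6, ∀ l < 7, 1 ≤ l →
    ((∀ q ∈ typesSix, ExtVanishes (i, l) q) ∨ (∀ q ∈ typesSix, ExtVanishes q (i, l))) →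
    (i, l) ∈ typesSix := by
  decide +kernel

end Combinatorics

variable {k R : Type u} [Field k] [Ring R] [Algebra k R] [Module.Finite k R] [IsNoetherianRing R]
  {n : ℕ} [NeZero n] (D : NakayamaData k R n)

/-- A version of `NakayamaData.isClusterTilting` that only mentions nonprojective summands. -/
theorem isClusterTilting_of_nonprojective [HasExt.{w} (FGModuleCat.{u} R)] {d : ℕ}
    {M : FGModuleCat.{u} R} {L : Set (ZMod n × ℕ)}
    (hM : 𝟙 M ∈ factorIdeal (D.uniserial (L ∪ {p | p.2 = n + 1})) M M)
    (hR : 𝟙 (FGModuleCat.of R R) ∈ factorIdeal (· = M) (FGModuleCat.of R R) _)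
    (hL : ∀ p ∈ L, ∃ X, D.IsUniserial p X ∧ 𝟙 X ∈ factorIdeal (· = M) X X)
    (hext : ∀ p ∈ L, ∀ q ∈ L, ∀ s, s + 2 ≤ d → ExtVanishes (syzygyType^[s] p) q)
    (hleft : ∀ p : ZMod n × ℕ, 1 ≤ p.2 → p.2 ≤ n →
      (∀ q ∈ L, ∀ s, s + 2 ≤ d → ExtVanishes (syzygyType^[s] p) q) → p ∈ L)
    (hright : ∀ p : ZMod n × ℕ, 1 ≤ p.2 → p.2 ≤ n →
      (∀ q ∈ L, ∀ s, s + 2 ≤ d → ExtVanishes (syzygyType^[s] q) p) → p ∈ L) :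
    IsClusterTilting.{w} d (additiveClosure M) := by
  have hLn : ∀ p ∈ L, p.2 ≤ n + 1 := fun p hp => by
    obtain ⟨X, hX, -⟩ := hL p hp
    exact hX.le
  refine D.isClusterTilting hM ?_ ?_ ?_ ?_
  · rintro ⟨i, l⟩ (hp | hp)
    · exact hL _ hp
    · obtain rfl : l = n + 1 := hp
      obtain ⟨X, hX⟩ := D.exists_isUniserial (p := (i, n + 1)) le_rfl
      have := D.projective_of_isUniserial hX
      exact ⟨X, hX, factorIdeal_trans (by rintro _ rfl; exact hR)
        (FGModuleCat.id_mem_factorIdeal_of_projective X)⟩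
  · rintro p (hp | hp) q (hq | hq) s hs
    · exact hext p hp q hq s hs
    · exact extVanishes_of_right (syzygyType_iterate_le (hLn p hp) s) hq
    · exact extVanishes_iterate_of_left hp q s
    · exact extVanishes_iterate_of_left hp q s
  · intro p h1 hl h
    rcases hl.lt_or_eq with hlt | heq
    · exact Or.inl (hleft p h1 (by omega) fun q hq => h q (Or.inl hq))
    · exact Or.inr heq
  · intro p h1 hl h
    rcases hl.lt_or_eq with hlt | heq
    · exact Or.inl (hright p h1 (by omega) fun q hq => h q (Or.inl hq))
    · exact Or.inr heq

theorem isClusterTilting_simple [HasExt.{w} (FGModuleCat.{u} R)] {M : FGModuleCat.{u} R}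
    (hM : 𝟙 M ∈ factorIdeal (D.uniserial ({(-1, 1)} ∪ {p | p.2 = n + 1})) M M)
    (hR : 𝟙 (FGModuleCat.of R R) ∈ factorIdeal (· = M) (FGModuleCat.of R R) _)
    (hL : ∃ X, D.IsUniserial (-1, 1) X ∧ 𝟙 X ∈ factorIdeal (· = M) X X) :
    IsClusterTilting.{w} (2 * n - 1) (additiveClosure M) := by
  refine D.isClusterTilting_of_nonprojective hM hR (by rintro _ rfl; exact hL) ?_ ?_ ?_
  · rintro _ rfl _ rfl s hs
    exact simple_extVanishes (by omega)
  · exact fun p h1 hl h => eq_simple_of_left h1 hl fun s hs => h _ rfl s (by omega)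
  · exact fun p h1 hl h => eq_simple_of_right h1 hl fun s hs => h _ rfl s (by omega)

theorem isClusterTilting_of_finset [HasExt.{w} (FGModuleCat.{u} R)]
    {M : FGModuleCat.{u} R} {L : Finset (ZMod n × ℕ)}
    (hM : 𝟙 M ∈ factorIdeal (D.uniserial (L ∪ {p | p.2 = n + 1})) M M)
    (hR : 𝟙 (FGModuleCat.of R R) ∈ factorIdeal (· = M) (FGModuleCat.of R R) _)
    (hL : ∀ p ∈ L, ∃ X, D.IsUniserial p X ∧ 𝟙 X ∈ factorIdeal (· = M) X X)
    (hext : ∀ p ∈ L, ∀ q ∈ L, ExtVanishes p q)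
    (hmem : ∀ i : ZMod n, ∀ l < n + 1, 1 ≤ l →
      ((∀ q ∈ L, ExtVanishes (i, l) q) ∨ (∀ q ∈ L, ExtVanishes q (i, l))) → (i, l) ∈ L) :
    IsClusterTilting.{w} 2 (additiveClosure M) := by
  refine D.isClusterTilting_of_nonprojective hM hR hL ?_ ?_ ?_
  · intro p hp q hq s hs
    obtain rfl : s = 0 := by omega
    exact hext p hp q hq
  · exact fun p h1 hl h => hmem p.1 p.2 (by omega) h1 (Or.inl fun q hq => h q hq 0 le_rfl)
  · exact fun p h1 hl h => hmem p.1 p.2 (by omega) h1 (Or.inr fun q hq => h q hq 0 le_rfl)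

end NakayamaData

/-! ### The trivial extension of the linear quiver as a Nakayama algebra -/

namespace LinearQuiver

variable {n : ℕ}

/-- The path of length `t` starting at `a`. -/
def path (a : LinearQuiver n) : ∀ (t : ℕ) (h : a.val + t < n),
    Quiver.Path a (⟨a.val + t, h⟩ : Fin n)
  | 0, _ => Quiver.Path.nil
  | t + 1, h => (path a t (by omega)).cons ⟨rfl⟩

variable (k : Type u) [Field k]

variable (n) in
/-- The path from `i` to `j`, counted from zero, as an element of the path algebra; zero if there
is no such path. -/
noncomputable def unit (i j : ℕ) : PathAlgebra k (LinearQuiver n) :=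
  if h : i ≤ j ∧ j < n then
    PathAlgebra.ofPath k (path (⟨i, h.1.trans_lt h.2⟩ : Fin n) (j - i)
      (by have := h.1; have := h.2; dsimp only; omega))
  else 0

theorem ofPath_congr {a b b' : LinearQuiver n} (p : Quiver.Path a b) (q : Quiver.Path a b')
    (h : b = b') : PathAlgebra.ofPath k p = PathAlgebra.ofPath k q := by
  subst h
  rw [Subsingleton.elim p q]

theorem le_of_path {a b : LinearQuiver n} (p : Quiver.Path a b) : a.val ≤ b.val := by
  have := path_length p
  omega

theorem ofPath_eq_unit {a b : LinearQuiver n} (p : Quiver.Path a b) :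
    PathAlgebra.ofPath k p = unit n k a.val b.val := by
  have hab := le_of_path p
  have hb := b.isLt
  rw [unit, dif_pos ⟨hab, hb⟩]
  refine ofPath_congr k p _ (Fin.ext ?_)
  dsimp only
  omega

theorem idem_eq_unit (a : LinearQuiver n) : PathAlgebra.idem k a = unit n k a.val a.val :=
  ofPath_eq_unit k _

theorem unit_eq_zero {i j : ℕ} (h : ¬ (i ≤ j ∧ j < n)) : unit n k i j = 0 := dif_neg h

theorem exists_unit_eq_ofPath {i j : ℕ} (h : i ≤ j ∧ j < n) :
    ∃ (a b : LinearQuiver n) (p : Quiver.Path a b), a.val = i ∧ b.val = j ∧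
      unit n k i j = PathAlgebra.ofPath k p := by
  refine ⟨_, _, _, ?_, ?_, dif_pos h⟩
  · rfl
  · have := h.1
    dsimp only
    omega

theorem unit_mul_unit {i j l : ℕ} (hij : i ≤ j) (hjl : j ≤ l) :
    unit n k i j * unit n k j l = unit n k i l := by
  by_cases hl : l < n
  · obtain ⟨a, b, p, rfl, rfl, hp⟩ := exists_unit_eq_ofPath (n := n) k ⟨hij, hjl.trans_lt hl⟩
    obtain ⟨b', c, q, hb, rfl, hq⟩ := exists_unit_eq_ofPath (n := n) k ⟨hjl, hl⟩
    obtain rfl : b' = b := Fin.ext hb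
    rw [hp, hq, PathAlgebra.ofPath_mul_ofPath, ofPath_eq_unit]
  · rw [unit_eq_zero k (i := j) (by omega), unit_eq_zero k (i := i) (j := l) (by omega), mul_zero]

theorem unit_mul_unit_of_ne {i j j' l : ℕ} (h : j ≠ j') :
    unit n k i j * unit n k j' l = 0 := by
  by_cases hij : i ≤ j ∧ j < n
  · by_cases hjl : j' ≤ l ∧ l < n
    · obtain ⟨a, b, p, rfl, rfl, hp⟩ := exists_unit_eq_ofPath (n := n) k hij
      obtain ⟨b', c, q, rfl, rfl, hq⟩ := exists_unit_eq_ofPath (n := n) k hjl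
      rw [hp, hq, PathAlgebra.ofPath_mul_ofPath_of_ne _ _ fun hb => h (by rw [hb])]
    · rw [unit_eq_zero k hjl, mul_zero]
  · rw [unit_eq_zero k hij, zero_mul]

variable (n) in
/-- The coefficient of the path from `i` to `j`, as an element of the dual bimodule. -/
noncomputable def coeff (i j : ℕ) : DualBimodule k (PathAlgebra k (LinearQuiver n)) :=
  Finsupp.lift k k (Quiver.AllPaths (LinearQuiver n)) fun p =>
    if p.1.val = i ∧ p.2.1.val = j then 1 else 0

theorem coeff_ofPath (i j : ℕ) {a b : LinearQuiver n} (p : Quiver.Path a b) :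
    coeff n k i j (PathAlgebra.ofPath k p) = if a.val = i ∧ b.val = j then 1 else 0 :=
  PathAlgebra.lift_single_one _ _

theorem coeff_unit (i j : ℕ) {p q : ℕ} (h : p ≤ q ∧ q < n) :
    coeff n k i j (unit n k p q) = if p = i ∧ q = j then 1 else 0 := by
  obtain ⟨a, b, p, rfl, rfl, hp⟩ := exists_unit_eq_ofPath (n := n) k h
  rw [hp, coeff_ofPath]

theorem unit_ne_zero {i j : ℕ} (h : i ≤ j ∧ j < n) : unit n k i j ≠ 0 := by
  intro h0
  have := coeff_unit k i j h
  rw [h0, if_pos ⟨rfl, rfl⟩] at this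
  exact zero_ne_one ((map_zero (show PathAlgebra k (LinearQuiver n) →ₗ[k] k from
    coeff n k i j)).symm.trans this)

variable {k}

theorem dual_ext {f g : DualBimodule k (PathAlgebra k (LinearQuiver n))}
    (h : ∀ p q, p ≤ q → q < n → f (unit n k p q) = g (unit n k p q)) : f = g :=
  PathAlgebra.hom_ext fun a b p => by
    rw [ofPath_eq_unit]
    exact h _ _ (le_of_path p) b.isLt

theorem dual_map_zero (f : DualBimodule k (PathAlgebra k (LinearQuiver n))) : f 0 = 0 :=
  map_zero (show PathAlgebra k (LinearQuiver n) →ₗ[k] k from f)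

variable (k)

theorem coeff_eq_zero {i j : ℕ} (h : j < i) : coeff n k i j = 0 :=
  dual_ext fun p q hpq hq => by
    rw [coeff_unit k _ _ ⟨hpq, hq⟩, if_neg (by omega)]
    rfl

variable (n) in
/-- The sum of all arrows of the linear quiver. -/
noncomputable def arrows : PathAlgebra k (LinearQuiver n) :=
  -- The summand t = n - 1 is zero because `unit` vanishes past the last vertex. This allows
  -- multiplication formulas without a boundary case.
  ∑ t ∈ Finset.range n, unit n k t (t + 1)

theorem unit_mul_arrows {i j : ℕ} (hij : i ≤ j) (hj : j < n) :
    unit n k i j * arrows n k = unit n k i (j + 1) := by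
  rw [arrows, Finset.mul_sum, Finset.sum_eq_single_of_mem j (Finset.mem_range.2 hj),
    unit_mul_unit k hij (Nat.le_succ j)]
  exact fun t _ ht => unit_mul_unit_of_ne k ht.symm

theorem arrows_mul_unit_zero (j : ℕ) : arrows n k * unit n k 0 j = 0 := by
  rw [arrows, Finset.sum_mul]
  exact Finset.sum_eq_zero fun t _ => unit_mul_unit_of_ne k (Nat.succ_ne_zero t)

theorem arrows_mul_unit_succ {i j : ℕ} (hij : i + 1 ≤ j) :
    arrows n k * unit n k (i + 1) j = unit n k i j := by
  by_cases hi : i < n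
  · rw [arrows, Finset.sum_mul, Finset.sum_eq_single_of_mem i (Finset.mem_range.2 hi),
      unit_mul_unit k (Nat.le_succ i) hij]
    exact fun t _ ht => unit_mul_unit_of_ne k (by omega)
  · rw [unit_eq_zero k (i := i + 1) (by omega), unit_eq_zero k (i := i) (by omega), mul_zero]

/-- A path followed by i → j can be the longest path only if j is the last vertex, and then it must
be 0 → i. -/
theorem unit_smul_coeff {i j : ℕ} (hij : i ≤ j) (hj : j < n) :
    unit n k i j • coeff n k 0 (n - 1) = if j + 1 = n then coeff n k 0 i else 0 :=
  dual_ext fun p q hpq hq => by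
    rw [DualBimodule.smul_apply]
    by_cases hqi : q = i
    · subst hqi
      rw [unit_mul_unit k hpq hij, coeff_unit k _ _ ⟨hpq.trans hij, hj⟩]
      by_cases hjn : j + 1 = n
      · rw [if_pos hjn, coeff_unit k _ _ ⟨hpq, hq⟩]
        exact if_congr (by omega) rfl rfl
      · rw [if_neg hjn, if_neg (by omega)]
        rfl
    · rw [unit_mul_unit_of_ne k hqi, dual_map_zero]
      split_ifs with hjn
      · rw [coeff_unit k _ _ ⟨hpq, hq⟩, if_neg (by tauto)]
      · rfl

/-- Prefixing an arrow lowers the source by one, so detecting the source i afterwards means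
detecting i + 1 before. -/
theorem op_arrows_smul_coeff (i j : ℕ) : op (arrows n k) • coeff n k i j = coeff n k (i + 1) j :=
  dual_ext fun p q hpq hq => by
    rw [DualBimodule.op_smul_apply, coeff_unit k _ _ ⟨hpq, hq⟩]
    cases p with
    | zero => rw [arrows_mul_unit_zero, dual_map_zero, if_neg (by omega)]
    | succ p =>
      rw [arrows_mul_unit_succ k hpq, coeff_unit k _ _ ⟨by omega, hq⟩]
      exact if_congr (by omega) rfl rfl

theorem op_unit_smul_coeff (m : ℕ) : op (unit n k m m) • coeff n k 0 (n - 1) =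
    if m = 0 then coeff n k 0 (n - 1) else 0 :=
  dual_ext fun p q hpq hq => by
    rw [DualBimodule.op_smul_apply]
    by_cases hmp : m = p
    · subst hmp
      rw [unit_mul_unit k le_rfl hpq, coeff_unit k _ _ ⟨hpq, hq⟩]
      split_ifs with h1 h2 h2
      · rw [coeff_unit k _ _ ⟨hpq, hq⟩, if_pos h1]
      · omega
      · rw [coeff_unit k _ _ ⟨hpq, hq⟩, if_neg h1]
      · rfl
    · rw [unit_mul_unit_of_ne k hmp, dual_map_zero]
      split_ifs with h
      · rw [coeff_unit k _ _ ⟨hpq, hq⟩, if_neg (by omega)]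
      · rfl

theorem eq_sum_unit (x : PathAlgebra k (LinearQuiver n)) :
    x = ∑ i ∈ Finset.range n, ∑ j ∈ Finset.range n, coeff n k i j x • unit n k i j := by
  let F : PathAlgebra k (LinearQuiver n) →ₗ[k] PathAlgebra k (LinearQuiver n) :=
    ∑ i ∈ Finset.range n, ∑ j ∈ Finset.range n,
      LinearMap.smulRight (show PathAlgebra k (LinearQuiver n) →ₗ[k] k from coeff n k i j)
        (unit n k i j)
  have hF (x) : F x = ∑ i ∈ Finset.range n, ∑ j ∈ Finset.range n,
      coeff n k i j x • unit n k i j := by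
    simp only [F, LinearMap.sum_apply]
    rfl
  have : LinearMap.id = F := by
    refine PathAlgebra.hom_ext fun a b p => ?_
    have hab := le_of_path p
    have hb := b.isLt
    rw [LinearMap.id_apply, hF, ofPath_eq_unit,
      Finset.sum_eq_single_of_mem a.val (Finset.mem_range.2 (hab.trans_lt hb)),
      Finset.sum_eq_single_of_mem b.val (Finset.mem_range.2 hb),
      coeff_unit k _ _ ⟨hab, hb⟩, if_pos ⟨rfl, rfl⟩, one_smul]
    · intro j _ hj
      rw [coeff_unit k _ _ ⟨hab, hb⟩, if_neg (by tauto), zero_smul]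
    · intro i _ hi
      refine Finset.sum_eq_zero fun j _ => ?_
      rw [coeff_unit k _ _ ⟨hab, hb⟩, if_neg (by tauto), zero_smul]
  rw [← hF, ← this, LinearMap.id_apply]

theorem eq_sum_coeff (f : DualBimodule k (PathAlgebra k (LinearQuiver n))) :
    f = ∑ i ∈ Finset.range n, ∑ j ∈ Finset.range n, f (unit n k i j) • coeff n k i j := by
  refine dual_ext fun p q hpq hq => ?_
  let ev : DualBimodule k (PathAlgebra k (LinearQuiver n)) →+ k :=
    { toFun := fun f => f (unit n k p q), map_zero' := rfl, map_add' := fun _ _ => rfl }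
  change _ = ev _
  simp only [map_sum]
  have hev (i j : ℕ) : ev (f (unit n k i j) • coeff n k i j) =
      f (unit n k i j) * if p = i ∧ q = j then 1 else 0 := by
    rw [← coeff_unit k _ _ ⟨hpq, hq⟩]
    rfl
  simp only [hev]
  rw [Finset.sum_eq_single_of_mem p (Finset.mem_range.2 (hpq.trans_lt hq)),
    Finset.sum_eq_single_of_mem q (Finset.mem_range.2 hq), if_pos ⟨rfl, rfl⟩, mul_one]
  · intro j _ hj
    rw [if_neg (by tauto), mul_zero]
  · intro i _ hi
    refine Finset.sum_eq_zero fun j _ => ?_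
    rw [if_neg (by tauto), mul_zero]

open TrivSqZeroExt

variable (n) in
/-- The sum of all arrows of the cyclic quiver of the trivial extension. -/
noncomputable def cyclicArrows : TKQ k n := inl (arrows n k) + inr (coeff n k 0 (n - 1))

variable (n) in
/-- The path of length `j` starting at `i` in the cyclic quiver of the trivial extension. -/
noncomputable def cyclicPath (i j : ℕ) : TKQ k n :=
  -- Once the path has passed the last vertex it is the functional dual to the complementary arc,
  -- the linear path from i + j - n back to i.
  if i + j < n then inl (unit n k i (i + j)) else inr (coeff n k (i + j - n) i)

/-- Up to the last vertex the linear arrows extend the path, there the functional part supplies the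
arrow back to 0, and afterwards the complementary arc shrinks. It is a trivial path at j = n, so the
next product is zero. -/
theorem cyclicPath_mul_cyclicArrows {i j : ℕ} (hj : j ≤ n) :
    cyclicPath n k i j * cyclicArrows n k = if j < n then cyclicPath n k i (j + 1) else 0 := by
  rw [cyclicPath, cyclicArrows]
  split_ifs with h1 h2 h2
  · rw [mul_add, ← inl_mul, inl_mul_inr, unit_mul_arrows k (by omega) h1,
      unit_smul_coeff k (by omega) h1, cyclicPath]
    by_cases h : i + (j + 1) < n
    · rw [if_pos h, if_neg (by omega), inr_zero, add_zero, add_assoc]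
    · rw [if_neg h, if_pos (by omega), unit_eq_zero k (by omega), inl_zero, zero_add,
        show i + (j + 1) - n = 0 by omega]
  · omega
  · rw [mul_add, inr_mul_inl, inr_mul_inr, add_zero, op_arrows_smul_coeff, cyclicPath,
      if_neg (by omega), show i + j - n + 1 = i + (j + 1) - n by omega]
  · rw [mul_add, inr_mul_inl, inr_mul_inr, add_zero, op_arrows_smul_coeff,
      coeff_eq_zero k (by omega), inr_zero]

theorem unit_mul_cyclicArrows_pow {i j : ℕ} (hi : i < n) (hj : j ≤ n) :
    (inl (unit n k i i) : TKQ k n) * cyclicArrows n k ^ j = cyclicPath n k i j := by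
  induction j with
  | zero => rw [pow_zero, mul_one, cyclicPath, if_pos (by omega), add_zero]
  | succ j ih =>
    rw [pow_succ, ← mul_assoc, ih (by omega), cyclicPath_mul_cyclicArrows k (by omega),
      if_pos (by omega)]

theorem sum_unit : ∑ t ∈ Finset.range n, unit n k t t = 1 := by
  rw [PathAlgebra.one_def, Finset.sum_range]
  exact Finset.sum_congr rfl fun a _ => (ofPath_eq_unit k _).symm

theorem cyclicArrows_mul_unit (m : ℕ) (hm : m < n) :
    cyclicArrows n k * inl (unit n k m m) =
      if m = 0 then cyclicPath n k (n - 1) 1 else cyclicPath n k (m - 1) 1 := by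
  rw [cyclicArrows, add_mul, ← inl_mul, inr_mul_inl, op_unit_smul_coeff]
  cases m with
  | zero =>
    rw [arrows_mul_unit_zero, if_pos rfl, if_pos rfl, inl_zero, zero_add, cyclicPath,
      if_neg (by omega), show n - 1 + 1 - n = 0 by omega]
  | succ m =>
    rw [arrows_mul_unit_succ k le_rfl, if_neg (by omega), if_neg (by omega), inr_zero, add_zero,
      cyclicPath, if_pos (by omega)]
    rfl

theorem sum_zmod {M : Type*} [AddCommMonoid M] [NeZero n] (f : ℕ → M) :
    ∑ i : ZMod n, f i.val = ∑ t ∈ Finset.range n, f t := by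
  rw [Finset.sum_range]
  obtain ⟨m, rfl⟩ := Nat.exists_eq_succ_of_ne_zero (NeZero.ne n)
  rfl

theorem val_add_one [NeZero n] (i : ZMod n) :
    (i + 1).val = if i.val + 1 = n then 0 else i.val + 1 := by
  have hlt := ZMod.val_lt i
  have hi : i + 1 = ((i.val + 1 : ℕ) : ZMod n) := by simp
  rw [hi]
  split_ifs with h
  · rw [h, ZMod.natCast_self, ZMod.val_zero]
  · exact ZMod.val_natCast_of_lt (by omega)

theorem sum_inl_unit [NeZero n] : ∑ i : ZMod n, (inl (unit n k i.val i.val) : TKQ k n) = 1 := by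
  rw [sum_zmod (fun t => (inl (unit n k t t) : TKQ k n)), ← inl_sum, sum_unit, inl_one]

theorem cyclicArrows_pow [NeZero n] : cyclicArrows n k ^ (n + 1) = 0 := by
  rw [← one_mul (cyclicArrows n k ^ (n + 1)), ← sum_inl_unit, Finset.sum_mul]
  refine Finset.sum_eq_zero fun i _ => ?_
  rw [pow_succ, ← mul_assoc, unit_mul_cyclicArrows_pow k (ZMod.val_lt i) le_rfl,
    cyclicPath_mul_cyclicArrows k le_rfl, if_neg (lt_irrefl n)]

theorem cyclicPath_ne_zero {i : ℕ} (hi : i < n) : cyclicPath n k i n ≠ 0 := by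
  rw [cyclicPath, if_neg (by omega), Nat.add_sub_cancel]
  intro h
  have h0 : coeff n k i i = 0 := inr_injective (h.trans (inr_zero _).symm)
  have := coeff_unit k i i ⟨le_rfl, hi⟩
  rw [h0, if_pos ⟨rfl, rfl⟩] at this
  exact zero_ne_one this

/-- The cyclic paths of length at most n run through the basis of paths and its dual basis; the
functional of i → j is the cyclic path from j of length n + i - j. -/
theorem mem_of_cyclicPath_mem {V : Submodule k (TKQ k n)}
    (hV : ∀ i j, i < n → j ≤ n → cyclicPath n k i j ∈ V) (x : TKQ k n) : x ∈ V := by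
  rw [← inl_fst_add_inr_snd_eq x, eq_sum_unit k x.fst, eq_sum_coeff k x.snd, inl_sum, inr_sum]
  refine add_mem (sum_mem fun i hi => ?_) (sum_mem fun i hi => ?_)
  · rw [inl_sum]
    refine sum_mem fun j hj => ?_
    rw [inl_smul]
    refine V.smul_mem _ ?_
    by_cases hij : i ≤ j
    · have := hV i (j - i) (Finset.mem_range.1 hi) (by have := Finset.mem_range.1 hj; omega)
      rwa [cyclicPath, Nat.add_sub_cancel' hij, if_pos (Finset.mem_range.1 hj)] at this
    · rw [unit_eq_zero k (by tauto), inl_zero]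
      exact zero_mem _
  · rw [inr_sum]
    refine sum_mem fun j hj => ?_
    rw [inr_smul]
    refine V.smul_mem _ ?_
    have hj := Finset.mem_range.1 hj
    by_cases hij : i ≤ j
    · have := hV j (n + i - j) hj (by omega)
      rwa [cyclicPath, if_neg (by omega), show j + (n + i - j) - n = i by omega] at this
    · rw [coeff_eq_zero k (by omega), inr_zero]
      exact zero_mem _

variable (n) in
/-- The opposite of `T(kQ_n)` is a self-injective Nakayama algebra. -/
noncomputable def nakayamaData [NeZero n] : NakayamaData k (TKQ k n)ᵐᵒᵖ n where
  e i := op (inl (unit n k i.val i.val))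
  -- On right modules `a` acts by appending an arrow, hence from the vertex i to i + 1.
  a := op (cyclicArrows n k)
  e_mul_e_self i := by
    rw [← op_mul, ← inl_mul, unit_mul_unit k le_rfl le_rfl]
  e_mul_e_of_ne {i j} h := by
    rw [← op_mul, ← inl_mul, unit_mul_unit_of_ne k fun h' => h (ZMod.val_injective n h').symm,
      inl_zero, MulOpposite.op_zero]
  sum_e := (map_sum (opAddEquiv (α := TKQ k n)) _ _).symm.trans (congrArg op (sum_inl_unit k))
  a_mul_e i := by
    have hlt := ZMod.val_lt i
    rw [← op_mul, ← op_mul, cyclicArrows_mul_unit k _ (ZMod.val_lt _), val_add_one,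
      ← pow_one (cyclicArrows n k), unit_mul_cyclicArrows_pow k hlt NeZero.one_le]
    by_cases h : i.val + 1 = n
    · rw [if_pos h, if_pos rfl, show n - 1 = i.val by omega]
    · rw [if_neg h, if_neg (Nat.succ_ne_zero _), Nat.add_sub_cancel]
  a_pow := by
    rw [← op_pow, cyclicArrows_pow, MulOpposite.op_zero]
  a_pow_mul_e_ne i := by
    rw [← op_pow, ← op_mul, unit_mul_cyclicArrows_pow k (ZMod.val_lt i) le_rfl]
    exact fun h => cyclicPath_ne_zero k (ZMod.val_lt i) (op_injective h)
  span_eq_top := by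
    rw [eq_top_iff]
    intro x _
    refine mem_of_cyclicPath_mem k (V := Submodule.comap (opLinearEquiv k).toLinearMap
      (Submodule.span k (Set.range fun p : ℕ × ZMod n =>
        op (cyclicArrows n k) ^ p.1 * op (inl (unit n k p.2.val p.2.val)))))
      (fun i j hi hj => ?_) x.unop
    refine Submodule.subset_span ⟨(j, (i : ZMod n)), ?_⟩
    dsimp only
    rw [ZMod.val_natCast_of_lt hi, ← op_pow, ← op_mul, unit_mul_cyclicArrows_pow k hi hj]
    rfl

/-! ### The modules P_i and S_i as uniserial modules. -/

section Modules

variable [NeZero n]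

theorem nakayamaData_e_natCast {v : ℕ} (hv : v < n) :
    (nakayamaData n k).e v = op (inl (unit n k v v)) := by
  change op (inl (unit n k (v : ZMod n).val (v : ZMod n).val)) = _
  rw [ZMod.val_natCast_of_lt hv]

theorem nakayamaData_pow_smul {X : Type*} [AddCommGroup X] [Module (TKQ k n)ᵐᵒᵖ X] {x : X} {v : ℕ}
    (hv : v < n) (hx : (nakayamaData n k).e v • x = x) {j : ℕ} (hj : j ≤ n) :
    (nakayamaData n k).a ^ j • x = op (cyclicPath n k v j) • x := by
  conv_lhs => rw [← hx]
  rw [nakayamaData_e_natCast k hv, smul_smul]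
  change ((op (cyclicArrows n k)) ^ j * op (inl (unit n k v v))) • x = _
  rw [← op_pow, ← op_mul, unit_mul_cyclicArrows_pow k hv hj]

/-- The dual part of T(kQ_n) acts as zero on P_i, so powers of `a` extend the trivial path until the
last vertex is reached. -/
theorem isUniserial_projective (i : ℕ) (h : 1 ≤ i ∧ i ≤ n) :
    (nakayamaData n k).IsUniserial (((i - 1 : ℕ) : ZMod n), n - (i - 1)) (Pmod k n i h) := by
  let a : LinearQuiver n := vertex i h
  have hv : i - 1 < n := by omega
  let x : Pmod k n i h := ⟨PathAlgebra.idem k a, Submodule.mem_span_singleton_self _⟩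
  have hsmul (t : TKQ k n) (y : Pmod k n i h) :
      (show PathAlgebra k (LinearQuiver n) from (op t • y : Pmod k n i h).1) =
        (show PathAlgebra k (LinearQuiver n) from y.1) * t.fst := rfl
  have he : (nakayamaData n k).e ((i - 1 : ℕ) : ZMod n) • x = x := by
    rw [nakayamaData_e_natCast k hv]
    refine Subtype.ext ((hsmul _ _).trans ?_)
    change PathAlgebra.idem k a * unit n k (i - 1) (i - 1) = PathAlgebra.idem k a
    rw [idem_eq_unit]
    exact unit_mul_unit k le_rfl le_rfl
  have hpow {j : ℕ} (hj : j ≤ n) : (show PathAlgebra k (LinearQuiver n) from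
      ((nakayamaData n k).a ^ j • x : Pmod k n i h).1) =
        if i - 1 + j < n then unit n k (i - 1) (i - 1 + j) else 0 := by
    rw [nakayamaData_pow_smul k hv he hj]
    refine (hsmul _ _).trans ?_
    change PathAlgebra.idem k a * _ = _
    rw [idem_eq_unit]
    change unit n k (i - 1) (i - 1) * _ = _
    rw [cyclicPath]
    split_ifs with hj
    · exact unit_mul_unit k le_rfl (Nat.le_add_right _ _)
    · rw [fst_inr, mul_zero]
  refine ⟨x, he, ?_, ?_, ?_⟩
  · refine Subtype.ext ((hpow (by dsimp only; omega)).trans ?_)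
    rw [if_neg (by dsimp only; omega)]
    rfl
  · intro j hj h0
    dsimp only at hj
    have h1 := (hpow (j := j) (by omega)).symm.trans (congrArg Subtype.val h0)
    rw [if_pos (by omega)] at h1
    exact unit_ne_zero k (by omega) h1
  · rw [eq_top_iff]
    rintro ⟨z, hz⟩ -
    obtain ⟨c, rfl⟩ := Submodule.mem_span_singleton.1 hz
    exact Submodule.mem_span_singleton.2 ⟨op (inl c.unop), rfl⟩

theorem isUniserial_simple (i : ℕ) (h : 1 ≤ i ∧ i ≤ n) :
    (nakayamaData n k).IsUniserial (((i - 1 : ℕ) : ZMod n), 1) (Smod k n i h) := by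
  let a : LinearQuiver n := vertex i h
  have hv : i - 1 < n := by omega
  let x : Smod k n i h := (1 : k)
  have hsmul (t : TKQ k n) (y : Smod k n i h) :
      (show k from (op t • y : Smod k n i h)) = (show k from y) * PathAlgebra.aug a t.fst := rfl
  have he : (nakayamaData n k).e ((i - 1 : ℕ) : ZMod n) • x = x := by
    rw [nakayamaData_e_natCast k hv]
    refine (hsmul _ _).trans ?_
    change (1 : k) * PathAlgebra.aug a (unit n k a.val a.val) = 1
    rw [← idem_eq_unit, one_mul]
    exact (PathAlgebra.augₗ_ofPath a _).trans (if_pos rfl)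
  refine ⟨x, he, ?_, ?_, ?_⟩
  · rw [nakayamaData_pow_smul k hv he (by dsimp only; omega)]
    refine (hsmul _ _).trans ?_
    change (1 : k) * PathAlgebra.aug a (cyclicPath n k (i - 1) 1).fst = 0
    rw [one_mul, cyclicPath]
    split_ifs with hlt
    · obtain ⟨b, c, p, hb, hc, hp⟩ := exists_unit_eq_ofPath (n := n) k
        (i := i - 1) (j := i - 1 + 1) (by omega)
      rw [fst_inl, hp]
      refine (PathAlgebra.augₗ_ofPath a p).trans (if_neg fun heq => ?_)
      have h1 : b = a := congrArg (fun s => s.1) heq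
      have h2 : c = a := congrArg (fun s => s.2.1) heq
      rw [h1] at hb
      rw [h2] at hc
      omega
    · rw [fst_inr, map_zero]
  · intro j hj h0
    obtain rfl : j = 0 := by simpa using hj
    rw [pow_zero, one_smul] at h0
    exact one_ne_zero (α := k) h0
  · rw [eq_top_iff]
    intro z _
    refine Submodule.mem_span_singleton.2
      ⟨op (inl (algebraMap k _ (show k from z))), (hsmul _ _).trans ?_⟩
    change (1 : k) * PathAlgebra.aug a (algebraMap k _ (show k from z)) = z
    rw [one_mul, AlgHom.commutes]
    rfl

end Modules

end LinearQuiver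

/-- The regular right module is the regular left module of the opposite ring. -/
noncomputable def regularModuleIso (A : Type u) [Ring A] :
    regularModule A ≅ FGModuleCat.of Aᵐᵒᵖ Aᵐᵒᵖ :=
  LinearEquiv.toFGModuleCatIso
    { (opAddEquiv : A ≃+ Aᵐᵒᵖ) with map_smul' := fun _ _ => rfl }

/-! ### Iterated syzygies of uniserial modules. -/

namespace NakayamaData

variable {k R : Type u} [Field k] [Ring R] [Algebra k R] [IsNoetherianRing R]
  {n : ℕ} [NeZero n] (D : NakayamaData k R n)

/-- Syzygies of direct sums of uniserial modules, up to projective direct summands. -/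
theorem id_mem_factorIdeal_of_isSyzygy {S : Set (ZMod n × ℕ)} (hS : ∀ p ∈ S, p.2 ≤ n + 1)
    {M : FGModuleCat.{u} R}
    (hM : 𝟙 M ∈ factorIdeal (D.uniserial S ⊔ isProjective _) M M)
    (hM' : ∀ G, D.uniserial S G → 𝟙 G ∈ factorIdeal ((· = M) ⊔ isProjective _) G G)
    (j : ℕ) {N : FGModuleCat.{u} R} (hN : IsSyzygy M j N) :
    𝟙 N ∈ factorIdeal (D.uniserial (syzygyType^[j] '' S) ⊔ isProjective _) N N ∧
      ∀ G, D.uniserial (syzygyType^[j] '' S) G →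
        𝟙 G ∈ factorIdeal ((· = N) ⊔ isProjective _) G G := by
  induction j generalizing N with
  | zero =>
    obtain ⟨e⟩ := hN
    simp only [Function.iterate_zero, Set.image_id]
    refine ⟨id_mem_factorIdeal_of_comp_eq_id hM e.hom e.inv e.hom_inv_id, fun G hG =>
      factorIdeal_trans ?_ (hM' G hG)⟩
    rintro P (rfl | hP)
    · exact id_mem_factorIdeal_of_comp_eq_id
        (id_mem_factorIdeal (𝒢 := (· = N) ⊔ isProjective _) (Or.inl rfl)) e.inv e.hom e.inv_hom_id
    · exact id_mem_factorIdeal (𝒢 := (· = N) ⊔ isProjective _) (Or.inr hP)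
  | succ j ih =>
    obtain ⟨L, Q, i, p, w, hL, hQ, hT⟩ := hN
    obtain ⟨h1, h2⟩ := ih hL
    constructor
    · refine id_mem_factorIdeal_syzygy (𝒢 := D.uniserial (syzygyType^[j] '' S)) ?_ hT h1
      rintro G ⟨_, ⟨q, hq, rfl⟩, hG⟩
      obtain ⟨T, hT, hP, h3, hK⟩ := D.exists_shortExact_syzygy hG
      exact ⟨T, hT, hP, h3, _, ⟨q, hq, Function.iterate_succ_apply' _ _ _⟩, hK⟩
    -- The syzygy lemma with roles exchanged: the kernel of the projective cover of a uniserial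
    -- module is tested, and the given sequence over `L` supplies N.
    · rintro G ⟨_, ⟨q, hq, rfl⟩, hG⟩
      rw [Function.iterate_succ_apply'] at hG
      obtain ⟨X, hX⟩ := D.exists_isUniserial (syzygyType_iterate_le (hS q hq) j)
      obtain ⟨T, hT', hP, rfl, hK⟩ := D.exists_shortExact_syzygy hX
      refine hK.id_mem_factorIdeal hG (id_mem_factorIdeal_syzygy (𝒢 := (· = L)) ?_ hT'
        (h2 _ ⟨_, ⟨q, hq, rfl⟩, hX⟩))
      rintro _ rfl
      exact ⟨_, hT, hQ, rfl, rfl⟩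

/-- The syzygies Ω^{3i}, i = 0, …, 3, give (4, 2), (5, 1); (1, 5), (1, 6); (1, 2), (2, 1); (4, 5),
(4, 6). -/
theorem exists_typesSix : ∀ p ∈ typesSix, ∃ i : Fin 4,
    ∃ q ∈ ({(4, 2), (5, 1)} : Finset (ZMod 6 × ℕ)), syzygyType^[3 * (i : ℕ)] q = p := by
  decide +kernel

theorem iterate_mem_typesSix : ∀ i : Fin 4, ∀ q ∈ ({(4, 2), (5, 1)} : Finset (ZMod 6 × ℕ)),
    syzygyType^[3 * (i : ℕ)] q ∈ typesSix := by
  decide +kernel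

end NakayamaData

/-! ### The three cluster-tilting modules. -/

section Main

variable (k : Type u) [Field k] {n : ℕ} [NeZero n]

open LinearQuiver

theorem id_mem_factorIdeal_regularModule {S : Set (ZMod n × ℕ)} (hS : ∀ i, (i, n + 1) ∈ S) :
    𝟙 (regularModule (TKQ k n)) ∈ factorIdeal ((nakayamaData n k).uniserial S)
      (regularModule (TKQ k n)) _ :=
  id_mem_factorIdeal_of_comp_eq_id ((nakayamaData n k).id_mem_factorIdeal_regular hS)
    (regularModuleIso _).hom (regularModuleIso _).inv (regularModuleIso _).hom_inv_id

omit [NeZero n] in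
theorem id_mem_factorIdeal_of_regularModule
    {𝒢 : ObjectProperty (RightMod (TKQ k n))}
    (h : 𝟙 (regularModule (TKQ k n)) ∈ factorIdeal 𝒢 _ (regularModule (TKQ k n))) :
    𝟙 (FGModuleCat.of (TKQ k n)ᵐᵒᵖ (TKQ k n)ᵐᵒᵖ) ∈ factorIdeal 𝒢 _ _ :=
  id_mem_factorIdeal_of_comp_eq_id h
    (regularModuleIso _).inv (regularModuleIso _).hom (regularModuleIso _).inv_hom_id

theorem isClusterTiltingModule_simple (hn : 2 ≤ n) (h : 1 ≤ n ∧ n ≤ n) :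
    IsClusterTiltingModule (TKQ k n) (2 * n - 1)
      (Pmod k n n h ⊞ regularModule (TKQ k n)) := by
  have hP := isUniserial_projective k n h
  -- The last vertex, counted from zero, is n - 1 = -1 modulo n, so P_n has type (-1, 1).
  rw [show n - (n - 1) = 1 by omega, Nat.cast_sub h.1, ZMod.natCast_self, Nat.cast_one,
    zero_sub] at hP
  have hM := id_mem_factorIdeal (𝒢 := (· = (Pmod k n n h ⊞
    regularModule (TKQ k n)))) rfl
  exact (nakayamaData n k).isClusterTilting_simple
    (id_mem_factorIdeal_biprod (id_mem_factorIdeal ⟨_, Or.inl rfl, hP⟩)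
      (id_mem_factorIdeal_regularModule k fun _ => Or.inr rfl))
    (id_mem_factorIdeal_of_regularModule k (id_mem_factorIdeal_of_biprod_right hM))
    ⟨_, hP, id_mem_factorIdeal_of_biprod_left hM⟩

theorem isClusterTiltingModule_three :
    IsClusterTiltingModule (TKQ k 3) 2
      (Pmod k 3 1 (by norm_num) ⊞ Pmod k 3 2 (by norm_num) ⊞ Smod k 3 2 (by norm_num) ⊞
        regularModule (TKQ k 3)) := by
  have h1 : (nakayamaData 3 k).IsUniserial (0, 3) (Pmod k 3 1 (by norm_num)) :=
    isUniserial_projective k 1 _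
  have h2 : (nakayamaData 3 k).IsUniserial (1, 2) (Pmod k 3 2 (by norm_num)) :=
    isUniserial_projective k 2 _
  have h3 : (nakayamaData 3 k).IsUniserial (1, 1) (Smod k 3 2 (by norm_num)) :=
    isUniserial_simple k 2 _
  have hM := id_mem_factorIdeal (𝒢 := (· = (Pmod k 3 1 (by norm_num) ⊞ Pmod k 3 2 (by norm_num) ⊞
    Smod k 3 2 (by norm_num) ⊞ regularModule (TKQ k 3)))) rfl
  have hM2 := id_mem_factorIdeal_of_biprod_right hM
  have hM3 := id_mem_factorIdeal_of_biprod_right hM2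
  refine (nakayamaData 3 k).isClusterTilting_of_finset (L := NakayamaData.typesThree)
    (id_mem_factorIdeal_biprod ?_ (id_mem_factorIdeal_biprod ?_ (id_mem_factorIdeal_biprod ?_
      (id_mem_factorIdeal_regularModule k fun _ => Or.inr rfl))))
    (id_mem_factorIdeal_of_regularModule k (id_mem_factorIdeal_of_biprod_right hM3))
    ?_ NakayamaData.typesThree_extVanishes NakayamaData.mem_typesThree
  · exact id_mem_factorIdeal ⟨_, Or.inl (by decide), h1⟩
  · exact id_mem_factorIdeal ⟨_, Or.inl (by decide), h2⟩
  · exact id_mem_factorIdeal ⟨_, Or.inl (by decide), h3⟩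
  · intro p hp
    simp only [NakayamaData.typesThree, Finset.mem_insert, Finset.mem_singleton] at hp
    rcases hp with rfl | rfl | rfl
    · exact ⟨_, h1, id_mem_factorIdeal_of_biprod_left hM⟩
    · exact ⟨_, h2, id_mem_factorIdeal_of_biprod_left hM2⟩
    · exact ⟨_, h3, id_mem_factorIdeal_of_biprod_left hM3⟩

theorem isClusterTiltingModule_six (N : Fin 4 → RightMod (TKQ k 6))
    (hN : ∀ i : Fin 4,
      IsSyzygy (Pmod k 6 5 (by norm_num) ⊞ Pmod k 6 6 (by norm_num)) (3 * (i : ℕ)) (N i)) :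
    IsClusterTiltingModule (TKQ k 6) 2 (regularModule (TKQ k 6) ⊞ ⨁ N) := by
  let S : Finset (ZMod 6 × ℕ) := {(4, 2), (5, 1)}
  let D := nakayamaData 6 k
  have h5 : D.IsUniserial (4, 2) (Pmod k 6 5 (by norm_num)) := isUniserial_projective k 5 _
  have h6 : D.IsUniserial (5, 1) (Pmod k 6 6 (by norm_num)) := isUniserial_projective k 6 _
  have hM := id_mem_factorIdeal (𝒢 := (· = (regularModule (TKQ k 6) ⊞ ⨁ N))) rfl
  have hR := id_mem_factorIdeal_of_regularModule k (id_mem_factorIdeal_of_biprod_left hM)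
  have hMN := id_mem_factorIdeal_of_biproduct N (id_mem_factorIdeal_of_biprod_right hM)
  have hP {𝒢 : ObjectProperty (RightMod (TKQ k 6))}
      (h : 𝟙 (FGModuleCat.of (TKQ k 6)ᵐᵒᵖ (TKQ k 6)ᵐᵒᵖ) ∈ factorIdeal 𝒢 _ _)
      (P : RightMod (TKQ k 6)) (hP : Projective P) : 𝟙 P ∈ factorIdeal 𝒢 P P :=
    factorIdeal_trans (by rintro _ rfl; exact h) (FGModuleCat.id_mem_factorIdeal_of_projective P)
  have hsyz (i : Fin 4) := D.id_mem_factorIdeal_of_isSyzygy (S := S) (by decide)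
    (M := Pmod k 6 5 (by norm_num) ⊞ Pmod k 6 6 (by norm_num))
    (id_mem_factorIdeal_biprod
      (id_mem_factorIdeal (𝒢 := D.uniserial S ⊔ isProjective _) (Or.inl ⟨_, by decide, h5⟩))
      (id_mem_factorIdeal (𝒢 := D.uniserial S ⊔ isProjective _) (Or.inl ⟨_, by decide, h6⟩)))
    (by
      have hL := id_mem_factorIdeal (𝒢 := (· = (Pmod k 6 5 (by norm_num) ⊞
        Pmod k 6 6 (by norm_num))) ⊔ isProjective _) (Or.inl rfl)
      rintro G ⟨p, hp, hG⟩
      simp only [S, Finset.coe_insert, Finset.coe_singleton, Set.mem_insert_iff,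
        Set.mem_singleton_iff] at hp
      rcases hp with rfl | rfl
      · exact h5.id_mem_factorIdeal hG (id_mem_factorIdeal_of_biprod_left hL)
      · exact h6.id_mem_factorIdeal hG (id_mem_factorIdeal_of_biprod_right hL))
    (3 * (i : ℕ)) (hN i)
  have hreg {S : Set (ZMod 6 × ℕ)} := id_mem_factorIdeal_regularModule k (n := 6)
    (S := S ∪ {p | p.2 = 6 + 1}) fun _ => Or.inr rfl
  refine D.isClusterTilting_of_finset (L := NakayamaData.typesSix)
    (id_mem_factorIdeal_biprod hreg (id_mem_factorIdeal_biproduct N fun i =>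
      factorIdeal_trans ?_ (hsyz i).1)) hR ?_ NakayamaData.typesSix_extVanishes
    NakayamaData.mem_typesSix
  -- The projective summands introduced by arbitrary choices of syzygies are absorbed by the regular
  -- module.
  · rintro G (⟨_, ⟨q, hq, rfl⟩, hG⟩ | hG)
    · exact id_mem_factorIdeal ⟨_, Or.inl (NakayamaData.iterate_mem_typesSix i q hq), hG⟩
    · exact hP (id_mem_factorIdeal_of_regularModule k hreg) G hG
  · intro p hp
    obtain ⟨i, q, hq, rfl⟩ := NakayamaData.exists_typesSix p hp
    obtain ⟨X, hX⟩ := D.exists_isUniserial (NakayamaData.syzygyType_iterate_le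
      ((by decide : ∀ q ∈ S, q.2 ≤ 6 + 1) q hq) (3 * (i : ℕ)))
    refine ⟨X, hX, factorIdeal_trans ?_ ((hsyz i).2 X ⟨_, ⟨q, hq, rfl⟩, hX⟩)⟩
    rintro G (rfl | hG)
    · exact hMN i
    · exact hP hR G hG

end Main

theorem proposition5p1 (k : Type u) [Field k] :
    (∀ (n : ℕ) (hn : 2 ≤ n),
      IsClusterTiltingModule (TKQ k n) (2 * n - 1)
        (Pmod k n n ⟨by omega, le_rfl⟩ ⊞ regularModule (TKQ k n))) ∧
    IsClusterTiltingModule (TKQ k 3) 2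
      (Pmod k 3 1 (by norm_num) ⊞ Pmod k 3 2 (by norm_num) ⊞ Smod k 3 2 (by norm_num) ⊞
        regularModule (TKQ k 3)) ∧
    (∀ N : Fin 4 → RightMod (TKQ k 6),
      (∀ i : Fin 4,
        IsSyzygy (Pmod k 6 5 (by norm_num) ⊞ Pmod k 6 6 (by norm_num)) (3 * (i : ℕ)) (N i)) →
      IsClusterTiltingModule (TKQ k 6) 2 (regularModule (TKQ k 6) ⊞ ⨁ N)) := by
  refine ⟨fun n hn => ?_, isClusterTiltingModule_three k, isClusterTiltingModule_six k⟩
  have : NeZero n := ⟨by omega⟩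
  exact isClusterTiltingModule_simple k hn _
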